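/- Let $d\ge 2$, $\alpha>-1$ and $k\in\{0,1,\dots,d-1\}$. Let $\mathbb S^d_+=\{x\in\mathbb R^{d+1}:\|x\|=1,\ x_{d+1}>0\}$ be the open upper hemisphere of the unit sphere $\mathbb S^d$. For $n\ge 1$ let $\widehat X_1,\dots,\widehat X_n$ be independent random points in $\mathbb S^d_+$, each distributed with density proportional to $x_{d+1}^{\alpha}$ with respect to the spherical Lebesgue measure, and let $\widehat K_n^\alpha$ be their spherical convex hull, i.e. the smallest spherically convex subset of $\mathbb S^d$ that contains them. Let $f_k(\widehat K_n^\alpha)$ be the number of $k$-dimensional faces of the spherical polytope $\widehat K_n^\alpha$. Then $f_k(\widehat K_n^\alpha)$ is square integrable, and there is a constant $c>0$, depending only on $d$, $\alpha$ and $k$, such that $$\mathrm{Var}\, f_k(\widehat K_n^\alpha)\ \ge\ c\qquad\text{for all } n\ge d+2 .$$ -/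

import Mathlib

open MeasureTheory ProbabilityTheory

noncomputable section

/-- The unit sphere `𝕊^d` in `ℝ^(d+1)`, as a type. -/
abbrev UnitSphere (d : ℕ) : Type :=
  Metric.sphere (0 : EuclideanSpace ℝ (Fin (d + 1))) 1

/-- The open upper hemisphere: the points of `𝕊^d` whose last coordinate is positive. -/
def openHemisphere (d : ℕ) : Set (UnitSphere d) :=
  {x | 0 < (x : EuclideanSpace ℝ (Fin (d + 1))) (Fin.last d)}

/-- The measure on `𝕊^d` that is supported on the open upper hemisphere and has there the density
`x_{d+1} ^ α` with respect to the spherical Lebesgue measure. -/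
def hemisphereWeight (d : ℕ) (α : ℝ) : Measure (UnitSphere d) :=
  ((volume : Measure (EuclideanSpace ℝ (Fin (d + 1)))).toSphere.restrict
    (openHemisphere d)).withDensity
      fun x => ENNReal.ofReal ((x : EuclideanSpace ℝ (Fin (d + 1))) (Fin.last d) ^ α)

/-- The distribution on the open upper hemisphere whose density with respect to the spherical
Lebesgue measure is proportional to `x_{d+1} ^ α`: the total mass is normalized to one. -/
def hemisphereLaw (d : ℕ) (α : ℝ) : Measure (UnitSphere d) :=
  (hemisphereWeight d α Set.univ)⁻¹ • hemisphereWeight d α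

/-- A subset of the unit sphere is spherically convex if with any two of its points it contains
the shortest geodesic arc between them. The points of that arc are the normalized nonnegative
combinations of the two end points; for antipodal or equal points these are only the two points
themselves, so that there is no condition. -/
def SphericallyConvex {d : ℕ} (C : Set (EuclideanSpace ℝ (Fin (d + 1)))) : Prop :=
  C ⊆ Metric.sphere 0 1 ∧
    ∀ x ∈ C, ∀ y ∈ C, ∀ a b : ℝ, 0 ≤ a → 0 ≤ b → a • x + b • y ≠ 0 →
      ‖a • x + b • y‖⁻¹ • (a • x + b • y) ∈ C

/-- The spherical convex hull: the smallest spherically convex set that contains `S`. -/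
def sphericalHull {d : ℕ} (S : Set (EuclideanSpace ℝ (Fin (d + 1)))) :
    Set (EuclideanSpace ℝ (Fin (d + 1))) :=
  ⋂₀ {C | SphericallyConvex C ∧ S ⊆ C}

/-- `F` is a face of the spherical polytope `K`: either `K` itself (`u = 0`), or the intersection
of `K` with a great subsphere `{x | ⟪u, x⟫ = 0}` such that `K` lies in the closed hemisphere
`{x | 0 ≤ ⟪u, x⟫}`. -/
def IsSphericalFace {d : ℕ} (K F : Set (EuclideanSpace ℝ (Fin (d + 1)))) : Prop :=
  ∃ u : EuclideanSpace ℝ (Fin (d + 1)),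
    (∀ x ∈ K, 0 ≤ inner ℝ u x) ∧ F = {x ∈ K | inner ℝ u x = 0}

/-- The number `f_k(K)` of `k`-dimensional faces of the spherical polytope `K`, where the dimension
of a spherical face is one less than the dimension of its linear hull. -/
def sphericalFaceCount {d : ℕ} (k : ℕ) (K : Set (EuclideanSpace ℝ (Fin (d + 1)))) : ℕ :=
  {F | IsSphericalFace K F ∧ Module.finrank ℝ (Submodule.span ℝ F) = k + 1}.ncard

/-- The spherical polytope generated by the points `x_1, …, x_n` of the sphere. -/
def sphericalPolytope {d n : ℕ} (x : Fin n → UnitSphere d) :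
    Set (EuclideanSpace ℝ (Fin (d + 1))) :=
  sphericalHull (Set.range fun i => (x i : EuclideanSpace ℝ (Fin (d + 1))))

end

/-!
The proof compares two events, each of probability bounded away from zero uniformly in `n`, on
which the face count takes different values; a variance bound follows by Chebyshev's inequality
(`div_four_le_variance`).

*Faces.* A face of the spherical polytope is determined by the generators on which a supporting
functional vanishes, so that `f_k` counts exposed index sets (`sphericalFaceCount_eq`). Hence `f_k`
is bounded by `2 ^ n`, and it is measurable. It only depends on linear relations between the
generators. If `d + 1` of them are linearly independent and all others are positive combinations of
these, then `f_k ≤ (d + 1).choose (k + 1)` (`ncard_exposed_le_choose`). If one further generator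
lies beyond exactly one facet of the simplicial cone, the polytope is a bipyramid over a simplex,
and `f_k` is strictly larger (`choose_lt_ncard_exposed`).

*Probabilities.* In polar coordinates the law of a point is a ratio of weights of cones in
`ℝ^(d+1)` (`hemisphereLaw_eq_div`). Scaling the last coordinate by `ε` multiplies the weight
`x_{d+1} ^ α dx` by `ε ^ (α + 1)` (`halfSpaceWeight_eq_preimage_scaleLast`). So there is a scale
`ε`, with `ε ^ (α + 1)` of order `1 / n`, at which the gnomonic projection, scaled by `ε`, of a single
point misses the unit cube with probability at most `1 / (2 * n)` and hits a given ball with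
probability at least of order `1 / n` (`exists_scale`). Among `n` independent points, with
probability bounded below, each of `d + 1` or `d + 2` disjoint balls receives exactly one point
while all other points project into the cube (`le_prob_exists_embedding`).

*Position.* The balls are centred at the vertices of a simplex around the cube and, for the second
event, at a point beyond one facet. By continuity and compactness all sign conditions on
coefficients persist for points in small balls (`exists_radius_scaledCoeff`), and they are invariant
under the scaling, as it comes from a linear map (`gnomonicCell_relations`).
-/

/-! ### Spherical hulls and their faces -/

open scoped NNReal in
/-- The spherical hull is the trace on the sphere of the convex cone that the points generate. -/
theorem sphericalHull_eq {d : ℕ} {S : Set (EuclideanSpace ℝ (Fin (d + 1)))}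
    (hS : S ⊆ Metric.sphere 0 1) :
    sphericalHull S = {x | x ∈ Metric.sphere 0 1 ∧ x ∈ Submodule.span ℝ≥0 S} := by
  apply Set.Subset.antisymm
  · apply Set.sInter_subset_of_mem
    refine ⟨⟨fun x hx => hx.1, ?_⟩, fun x hx => ⟨hS hx, Submodule.subset_span hx⟩⟩
    rintro x ⟨-, hx⟩ y ⟨-, hy⟩ a b ha hb hab
    constructor
    · rw [mem_sphere_zero_iff_norm, norm_smul, norm_inv, norm_norm,
        inv_mul_cancel₀ (norm_ne_zero_iff.2 hab)]
    · lift a to ℝ≥0 using ha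
      lift b to ℝ≥0 using hb
      exact Submodule.smul_mem _ (⟨_, inv_nonneg.2 (norm_nonneg _)⟩ : ℝ≥0)
        (Submodule.add_mem _ (Submodule.smul_mem _ a hx) (Submodule.smul_mem _ b hy))
  · rintro x ⟨hx1, hx⟩ C ⟨⟨hC1, hC⟩, hSC⟩
    -- Spherical convexity only reaches nonzero vectors, hence the alternative.
    have key : x = 0 ∨ ‖x‖⁻¹ • x ∈ C := by
      clear hx1
      induction hx using Submodule.span_induction with
      | mem y hy =>
        right
        have : ‖y‖ = 1 := by simpa using hS hy
        simpa [this] using hSC hy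
      | zero => exact Or.inl rfl
      | add y z _ _ hy hz =>
        rcases hy with rfl | hy
        · simpa using hz
        rcases hz with rfl | hz
        · simpa using Or.inr hy
        by_cases h0 : y + z = 0
        · exact Or.inl h0
        right
        have e : ∀ v : EuclideanSpace ℝ (Fin (d + 1)), ‖v‖ • ‖v‖⁻¹ • v = v := by
          intro v
          by_cases hv : v = 0
          · simp [hv]
          · rw [smul_smul, mul_inv_cancel₀ (norm_ne_zero_iff.2 hv), one_smul]
        have := hC _ hy _ hz ‖y‖ ‖z‖ (norm_nonneg _) (norm_nonneg _)
        rw [e, e] at this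
        exact this h0
      | smul a y _ hy =>
        rcases hy with rfl | hy
        · simp
        by_cases ha : a = 0
        · simp [ha]
        by_cases h0 : y = 0
        · simp [h0]
        right
        have ha' : (a : ℝ) ≠ 0 := by exact_mod_cast ha
        have : ‖a • y‖⁻¹ • a • y = ‖y‖⁻¹ • y := by
          change ‖(a : ℝ) • y‖⁻¹ • (a : ℝ) • y = _
          rw [norm_smul, smul_smul, Real.norm_of_nonneg (NNReal.coe_nonneg a), mul_inv, mul_comm,
            ← mul_assoc, mul_inv_cancel₀ ha', one_mul]
        rwa [this]
    have hx1 : ‖x‖ = 1 := by simpa using hx1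
    rcases key with rfl | h
    · simp at hx1
    · simpa [hx1] using h

/-- A set `T` of indices is exposed by the vectors `x i` if some linear functional vanishes at
`x i` for `i ∈ T` and is positive at the other vectors: these are the index sets of the faces of
the cone generated by the vectors. -/
def IsExposedIndexSet {ι E : Type*} [NormedAddCommGroup E] [InnerProductSpace ℝ E]
    (x : ι → E) (T : Finset ι) : Prop :=
  ∃ u : E, (∀ i ∈ T, inner ℝ u (x i) = 0) ∧ ∀ i ∉ T, 0 < inner ℝ u (x i)

open scoped NNReal in
theorem mem_span_image_of_inner_eq_zero {ι E : Type*} [NormedAddCommGroup E]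
    [InnerProductSpace ℝ E] {x : ι → E} {T : Finset ι} {u : E}
    (h0 : ∀ i ∈ T, inner ℝ u (x i) = 0) (h1 : ∀ i ∉ T, 0 < inner ℝ u (x i)) {y : E}
    (hy : y ∈ Submodule.span ℝ≥0 (Set.range x)) :
    0 ≤ inner ℝ u y ∧ (inner ℝ u y = 0 → y ∈ Submodule.span ℝ≥0 (x '' T)) := by
  induction hy using Submodule.span_induction with
  | mem y hy =>
    obtain ⟨i, rfl⟩ := hy
    by_cases hi : i ∈ T
    · exact ⟨(h0 i hi).ge, fun _ => Submodule.subset_span ⟨i, hi, rfl⟩⟩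
    · exact ⟨(h1 i hi).le, fun h => absurd h (h1 i hi).ne'⟩
  | zero => simp
  | add y z _ _ hy hz =>
    rw [inner_add_right]
    refine ⟨add_nonneg hy.1 hz.1, fun h => ?_⟩
    exact Submodule.add_mem _ (hy.2 (by linarith [hy.1, hz.1])) (hz.2 (by linarith [hy.1, hz.1]))
  | smul a y _ hy =>
    have e : inner ℝ u (a • y) = (a : ℝ) * inner ℝ u y := inner_smul_right u y (a : ℝ)
    rw [e]
    refine ⟨mul_nonneg a.2 hy.1, fun h => ?_⟩
    rcases mul_eq_zero.1 h with h | h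
    · have : a = 0 := by exact_mod_cast h
      simp [this]
    · exact Submodule.smul_mem _ _ (hy.2 h)

open scoped NNReal in
theorem inner_eq_zero_of_mem_span_image {ι E : Type*} [NormedAddCommGroup E]
    [InnerProductSpace ℝ E] {x : ι → E} {T : Finset ι} {u : E}
    (h0 : ∀ i ∈ T, inner ℝ u (x i) = 0) {y : E}
    (hy : y ∈ Submodule.span ℝ≥0 (x '' T)) : inner ℝ u y = 0 := by
  induction hy using Submodule.span_induction with
  | mem y hy =>
    obtain ⟨i, hi, rfl⟩ := hy
    exact h0 i hi
  | zero => simp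
  | add y z _ _ hy hz => rw [inner_add_right, hy, hz, add_zero]
  | smul a y _ hy =>
    have e : inner ℝ u (a • y) = (a : ℝ) * inner ℝ u y := inner_smul_right u y (a : ℝ)
    rw [e, hy, mul_zero]

open scoped NNReal in
/-- Faces of a spherical polytope correspond to exposed sets of generators. -/
theorem sphericalFaceCount_eq {d n : ℕ} (k : ℕ) (x : Fin n → UnitSphere d) :
    sphericalFaceCount k (sphericalPolytope x) =
      {T : Finset (Fin n) |
        IsExposedIndexSet (fun i => (x i : EuclideanSpace ℝ (Fin (d + 1)))) T ∧
        Module.finrank ℝ (Submodule.span ℝ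
          ((fun i => (x i : EuclideanSpace ℝ (Fin (d + 1)))) '' T)) = k + 1}.ncard := by
  classical
  set y : Fin n → EuclideanSpace ℝ (Fin (d + 1)) := fun i => x i with hy
  have hy1 : ∀ i, y i ∈ Metric.sphere 0 1 := fun i => (x i).2
  have hK : sphericalPolytope x = {z | z ∈ Metric.sphere 0 1 ∧
      z ∈ Submodule.span ℝ≥0 (Set.range y)} :=
    sphericalHull_eq (by rintro _ ⟨i, rfl⟩; exact hy1 i)
  -- The face with generators indexed by `T`.
  let Φ : Finset (Fin n) → Set (EuclideanSpace ℝ (Fin (d + 1))) := fun T =>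
    {z | z ∈ Metric.sphere 0 1 ∧ z ∈ Submodule.span ℝ≥0 (y '' T)}
  have hΦ : ∀ (T : Finset (Fin n)) (u : EuclideanSpace ℝ (Fin (d + 1))),
      (∀ i ∈ T, inner ℝ u (y i) = 0) → (∀ i ∉ T, 0 < inner ℝ u (y i)) →
      {z ∈ sphericalPolytope x | inner ℝ u z = 0} = Φ T := by
    intro T u h0 h1
    ext z
    rw [hK]
    constructor
    · rintro ⟨⟨hz1, hz⟩, hu⟩
      exact ⟨hz1, (mem_span_image_of_inner_eq_zero h0 h1 hz).2 hu⟩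
    · rintro ⟨hz1, hz⟩
      exact ⟨⟨hz1, Submodule.span_mono (Set.image_subset_range _ _) hz⟩,
        inner_eq_zero_of_mem_span_image h0 hz⟩
  have hspan : ∀ T, Submodule.span ℝ (Φ T) = Submodule.span ℝ (y '' T) := by
    intro T
    apply le_antisymm
    · rw [Submodule.span_le]
      rintro z ⟨-, hz⟩
      exact Submodule.span_le_restrictScalars ℝ≥0 ℝ _ hz
    · apply Submodule.span_mono
      rintro _ ⟨i, hi, rfl⟩
      exact ⟨hy1 i, Submodule.subset_span ⟨i, hi, rfl⟩⟩
  rw [sphericalFaceCount, ← Set.InjOn.ncard_image (f := Φ)]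
  · congr 1
    ext F
    constructor
    · rintro ⟨⟨u, hu, rfl⟩, hF⟩
      have hui : ∀ i, 0 ≤ inner ℝ u (y i) := fun i => hu _ (by
        rw [hK]; exact ⟨hy1 i, Submodule.subset_span ⟨i, rfl⟩⟩)
      have h0 : ∀ i ∈ Finset.univ.filter (fun i => inner ℝ u (y i) = 0),
          inner ℝ u (y i) = 0 := fun i hi => (Finset.mem_filter.1 hi).2
      have h1 : ∀ i ∉ Finset.univ.filter (fun i => inner ℝ u (y i) = 0),
          0 < inner ℝ u (y i) := fun i hi =>
        lt_of_le_of_ne (hui i) (fun h => hi (Finset.mem_filter.2 ⟨Finset.mem_univ _, h.symm⟩))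
      have e := hΦ _ u h0 h1
      refine ⟨_, ⟨⟨u, h0, h1⟩, ?_⟩, e.symm⟩
      rw [← hspan, ← e, hF]
    · rintro ⟨T, ⟨⟨u, h0, h1⟩, hT⟩, rfl⟩
      refine ⟨⟨u, fun z hz => ?_, (hΦ T u h0 h1).symm⟩, by rw [hspan, hT]⟩
      rw [hK] at hz
      exact (mem_span_image_of_inner_eq_zero h0 h1 hz.2).1
  · rintro T ⟨⟨u, h0, h1⟩, -⟩ T' ⟨⟨u', h0', h1'⟩, -⟩ hTT
    have aux : ∀ (T : Finset (Fin n)) (u : EuclideanSpace ℝ (Fin (d + 1))),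
      (∀ i ∈ T, inner ℝ u (y i) = 0) → (∀ i ∉ T, 0 < inner ℝ u (y i)) →
        ∀ i, i ∈ T ↔ y i ∈ Φ T := by
      intro T u h0 h1 i
      refine ⟨fun hi => ⟨hy1 i, Submodule.subset_span ⟨i, hi, rfl⟩⟩, fun hi => ?_⟩
      by_contra hiT
      exact (h1 i hiT).ne' (inner_eq_zero_of_mem_span_image h0 hi.2)
    ext i
    rw [aux T u h0 h1, aux T' u' h0' h1', hTT]

/-! ### Measurability of the face count -/

/-- Rescaling the functional makes its positive values at least one; for functionals in a fixed
ball the resulting condition is closed, so that the whole set is a countable union of closed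
sets. -/
theorem measurableSet_isExposedIndexSet {ι E : Type*} [Fintype ι] [NormedAddCommGroup E]
    [InnerProductSpace ℝ E] [FiniteDimensional ℝ E] [MeasurableSpace E] [BorelSpace E]
    (T : Finset ι) : MeasurableSet {x : ι → E | IsExposedIndexSet x T} := by
  have : {x : ι → E | IsExposedIndexSet x T} = ⋃ m : ℕ, Prod.fst ''
      {p : (ι → E) × Metric.closedBall (0 : E) m | (∀ i ∈ T, inner ℝ (p.2 : E) (p.1 i) = 0) ∧
        ∀ i ∉ T, 1 ≤ inner ℝ (p.2 : E) (p.1 i)} := by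
    ext x
    simp only [Set.mem_ofPred_eq, Set.mem_iUnion, Set.mem_image, Prod.exists, exists_and_right,
      exists_eq_right]
    constructor
    · rintro ⟨u, h0, h1⟩
      obtain ⟨r, hr, hr1⟩ : ∃ r : ℝ, 0 < r ∧ ∀ i ∉ T, 1 ≤ r * inner ℝ u (x i) := by
        have hs : ∀ i ∉ T, 0 ≤ (inner ℝ u (x i))⁻¹ := fun i hi => (inv_pos.2 (h1 i hi)).le
        refine ⟨1 + ∑ i, |(inner ℝ u (x i))⁻¹|, by positivity, fun i hi => ?_⟩
        have h2 : (inner ℝ u (x i))⁻¹ ≤ 1 + ∑ i, |(inner ℝ u (x i))⁻¹| := by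
          have := Finset.single_le_sum (f := fun i => |(inner ℝ u (x i))⁻¹|)
            (fun i _ => abs_nonneg _) (Finset.mem_univ i)
          have h3 := le_abs_self (inner ℝ u (x i))⁻¹
          linarith
        calc (1 : ℝ) = (inner ℝ u (x i))⁻¹ * inner ℝ u (x i) :=
              (inv_mul_cancel₀ (h1 i hi).ne').symm
          _ ≤ _ := mul_le_mul_of_nonneg_right h2 (h1 i hi).le
      obtain ⟨m, hm⟩ := exists_nat_ge ‖r • u‖
      refine ⟨m, ⟨r • u, by simpa using hm⟩, fun i hi => ?_, fun i hi => ?_⟩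
      · simp [inner_smul_left, h0 i hi]
      · simpa [inner_smul_left] using hr1 i hi
    · rintro ⟨m, u, h0, h1⟩
      exact ⟨u, h0, fun i hi => one_pos.trans_le (h1 i hi)⟩
  rw [this]
  refine MeasurableSet.iUnion fun m => IsClosed.measurableSet ?_
  have : ProperSpace E := FiniteDimensional.proper ℝ E
  have : CompactSpace (Metric.closedBall (0 : E) m) :=
    isCompact_iff_compactSpace.1 (isCompact_closedBall _ _)
  apply isClosedMap_fst_of_compactSpace
  have hc : ∀ i, Continuous fun p : (ι → E) × Metric.closedBall (0 : E) m =>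
      inner ℝ (p.2 : E) (p.1 i) := fun i => by fun_prop
  simp only [Set.ofPred_and, Set.ofPred_forall]
  exact (isClosed_iInter fun i => isClosed_iInter fun _ =>
    isClosed_eq (hc i) continuous_const).inter
    (isClosed_iInter fun i => isClosed_iInter fun _ => isClosed_le continuous_const (hc i))

theorem measurableSet_finrank_span_image_eq {ι E : Type*} [Fintype ι] [NormedAddCommGroup E]
    [NormedSpace ℝ E] [FiniteDimensional ℝ E] [MeasurableSpace E] [BorelSpace E]
    (T : Finset ι) (r : ℕ) :
    MeasurableSet {x : ι → E | Module.finrank ℝ (Submodule.span ℝ (x '' T)) = r} := by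
  have hopen : ∀ s : ℕ, IsOpen {x : ι → E | s ≤ Module.finrank ℝ (Submodule.span ℝ (x '' T))} := by
    intro s
    have : {x : ι → E | s ≤ Module.finrank ℝ (Submodule.span ℝ (x '' T))} =
        ⋃ J : Fin s → T, (fun (x : ι → E) (j : Fin s) => x (J j)) ⁻¹'
          {y : Fin s → E | LinearIndependent ℝ y} := by
      ext x
      simp only [Set.mem_ofPred_eq, Set.mem_iUnion, Set.mem_preimage]
      constructor
      · intro hs
        obtain ⟨f, hf, -, hli⟩ := Submodule.exists_fun_fin_finrank_span_eq ℝ (x '' (T : Set ι))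
        choose J hJ hJx using hf
        refine ⟨fun j => ⟨J (Fin.castLE hs j), hJ _⟩, ?_⟩
        simp only [hJx]
        exact hli.comp _ (Fin.castLE_injective hs)
      · rintro ⟨J, hJ⟩
        have h1 := finrank_span_eq_card hJ
        rw [Fintype.card_fin] at h1
        rw [← h1]
        apply Submodule.finrank_mono
        apply Submodule.span_mono
        rintro _ ⟨j, rfl⟩
        exact ⟨J j, (J j).2, rfl⟩
    rw [this]
    refine isOpen_iUnion fun J => IsOpen.preimage (by fun_prop) isOpen_setOfPred_linearIndependent
  have : {x : ι → E | Module.finrank ℝ (Submodule.span ℝ (x '' T)) = r} =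
      {x : ι → E | r ≤ Module.finrank ℝ (Submodule.span ℝ (x '' T))} \
      {x : ι → E | r + 1 ≤ Module.finrank ℝ (Submodule.span ℝ (x '' T))} := by
    ext x
    simp only [Set.mem_ofPred_eq, Set.mem_sdiff]
    omega
  rw [this]
  exact (hopen r).measurableSet.diff (hopen _).measurableSet

theorem measurable_sphericalFaceCount (d n k : ℕ) :
    Measurable fun x : Fin n → UnitSphere d => sphericalFaceCount k (sphericalPolytope x) := by
  classical
  have : (fun x : Fin n → UnitSphere d => sphericalFaceCount k (sphericalPolytope x)) =
      fun x => ∑ T : Finset (Fin n), if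
        IsExposedIndexSet (fun i => (x i : EuclideanSpace ℝ (Fin (d + 1)))) T ∧
        Module.finrank ℝ (Submodule.span ℝ
          ((fun i => (x i : EuclideanSpace ℝ (Fin (d + 1)))) '' T)) = k + 1 then 1 else 0 := by
    funext x
    rw [sphericalFaceCount_eq, Set.ncard_eq_toFinset_card', ← Finset.card_filter]
    congr 1
    ext T
    simp
  rw [this]
  have hm : Measurable fun (x : Fin n → UnitSphere d) (i : Fin n) =>
      (x i : EuclideanSpace ℝ (Fin (d + 1))) := by fun_prop
  refine Finset.measurable_sum _ fun T _ => Measurable.ite ?_ measurable_const measurable_const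
  exact (hm (measurableSet_isExposedIndexSet T)).inter
    (hm (measurableSet_finrank_span_image_eq T (k + 1)))

theorem sphericalFaceCount_le {d n : ℕ} (k : ℕ) (x : Fin n → UnitSphere d) :
    sphericalFaceCount k (sphericalPolytope x) ≤ 2 ^ n := by
  rw [sphericalFaceCount_eq]
  refine (Set.ncard_le_card _).trans ?_
  simp

/-! ### Two configurations with different face counts -/

/-- If all generators outside a linearly independent family are positive combinations of that
family, the cone they generate is simplicial, and its faces are spanned by parts of the family. -/
theorem ncard_exposed_le_choose {ι J E : Type*} [Fintype ι] [Fintype J] [NormedAddCommGroup E]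
    [InnerProductSpace ℝ E] [FiniteDimensional ℝ E] {x : ι → E} {σ : J ↪ ι}
    (hli : LinearIndependent ℝ fun j => x (σ j))
    (hpos : ∀ i ∉ Set.range σ, ∃ c : J → ℝ, (∀ j, 0 < c j) ∧ x i = ∑ j, c j • x (σ j))
    {k : ℕ} (hk : k + 1 < Fintype.card J) :
    {T : Finset ι | IsExposedIndexSet x T ∧
      Module.finrank ℝ (Submodule.span ℝ (x '' T)) = k + 1}.ncard ≤
      (Fintype.card J).choose (k + 1) := by
  classical
  have hsub : {T : Finset ι | IsExposedIndexSet x T ∧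
      Module.finrank ℝ (Submodule.span ℝ (x '' T)) = k + 1} ⊆
      ((Finset.powersetCard (k + 1) (Finset.univ : Finset J)).image (Finset.map σ) :
        Finset (Finset ι)) := by
    rintro T ⟨⟨u, h0, h1⟩, hT⟩
    have hnn : ∀ i, 0 ≤ inner ℝ u (x i) := fun i => by
      by_cases hi : i ∈ T
      · exact (h0 i hi).ge
      · exact (h1 i hi).le
    have hrange : ∀ i ∈ T, i ∈ Set.range σ := by
      intro i hi
      by_contra hir
      obtain ⟨c, hc, hxi⟩ := hpos i hir
      have hsum := h0 i hi
      rw [hxi, inner_sum, Finset.sum_eq_zero_iff_of_nonneg] at hsum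
      · have hall : ∀ j, σ j ∈ T := by
          intro j
          by_contra hj
          have := hsum j (Finset.mem_univ j)
          rw [inner_smul_right] at this
          exact (mul_pos (hc j) (h1 _ hj)).ne' this
        have hle : Module.finrank ℝ (Submodule.span ℝ (Set.range fun j => x (σ j))) ≤
            Module.finrank ℝ (Submodule.span ℝ (x '' T)) := by
          apply Submodule.finrank_mono
          apply Submodule.span_mono
          rintro _ ⟨j, rfl⟩
          exact ⟨σ j, hall j, rfl⟩
        rw [finrank_span_eq_card hli, hT] at hle
        omega
      · intro j _
        rw [inner_smul_right]
        exact mul_nonneg (hc j).le (hnn _)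
    have hTS : T = (Finset.univ.filter fun j => σ j ∈ T).map σ := by
      ext i
      simp only [Finset.mem_map, Finset.mem_filter, Finset.mem_univ, true_and]
      constructor
      · intro hi
        obtain ⟨j, rfl⟩ := hrange i hi
        exact ⟨j, hi, rfl⟩
      · rintro ⟨j, hj, rfl⟩
        exact hj
    generalize (Finset.univ.filter fun j => σ j ∈ T) = S at hTS
    subst hTS
    simp only [Finset.coe_image, Set.mem_image, Finset.mem_coe, Finset.mem_powersetCard]
    refine ⟨S, ⟨Finset.subset_univ _, ?_⟩, rfl⟩
    have := finrank_span_eq_card (hli.comp ((↑) : S → J) Subtype.val_injective)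
    rw [Fintype.card_coe] at this
    have hset : Set.range ((fun j => x (σ j)) ∘ ((↑) : S → J)) = x '' (S.map σ) := by
      ext y
      simp
    rw [← this, ← hT, hset]
  calc _ ≤ _ := Set.ncard_le_ncard hsub (Finset.finite_toSet _)
    _ ≤ _ := by
      rw [Set.ncard_coe_finset]
      exact Finset.card_image_le.trans (by rw [Finset.card_powersetCard, Finset.card_univ])

theorem LinearIndependent.exists_inner_eq {J E : Type*} [NormedAddCommGroup E]
    [InnerProductSpace ℝ E] [FiniteDimensional ℝ E] {v : J → E} (hv : LinearIndependent ℝ v)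
    (s : J → ℝ) : ∃ u : E, ∀ j, inner ℝ u (v j) = s j := by
  have := FiniteDimensional.complete ℝ E
  obtain ⟨f, hf⟩ := LinearMap.exists_extend
    ((Module.Basis.span hv).constr ℝ s : Submodule.span ℝ (Set.range v) →ₗ[ℝ] ℝ)
  refine ⟨(InnerProductSpace.toDual ℝ E).symm (LinearMap.toContinuousLinearMap f), fun j => ?_⟩
  rw [InnerProductSpace.toDual_symm_apply]
  have h := LinearMap.congr_fun hf ((Module.Basis.span hv) j)
  rw [Module.Basis.constr_basis] at h
  rw [← h]
  simp [Module.Basis.span_apply]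

/-- The proper faces of a bipyramid over a simplex. The vertices of the simplex are `some j` with
`j ≠ Fin.last d`, the apexes are `none` and `some (Fin.last d)`; a set of vertices
spans a face unless it contains both apexes or the whole simplex. -/
def IsBipyramidFace {d : ℕ} (S : Finset (Option (Fin (d + 1)))) : Prop :=
  (none ∉ S ∨ some (Fin.last d) ∉ S) ∧ ∃ j : Fin (d + 1), j ≠ Fin.last d ∧ some j ∉ S

/-- A `d`-dimensional bipyramid over a simplex has more `k`-faces than a `d`-simplex. -/
theorem choose_lt_ncard_isBipyramidFace {d k : ℕ} (hd : 2 ≤ d) (hk : k < d) :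
    (d + 1).choose (k + 1) <
      {S : Finset (Option (Fin (d + 1))) | IsBipyramidFace S ∧ S.card = k + 1}.ncard := by
  classical
  -- The faces that avoid the apex `none`, and those that contain it.
  let A : Finset (Finset (Option (Fin (d + 1)))) :=
    ((Finset.powersetCard (k + 1) (Finset.univ : Finset (Fin (d + 1)))).erase
      (Finset.univ.erase (Fin.last d))).image (Finset.map Function.Embedding.some)
  let B : Finset (Finset (Option (Fin (d + 1)))) :=
    (Finset.powersetCard k ((Finset.univ : Finset (Fin (d + 1))).erase (Fin.last d))).image
      Finset.insertNone
  have hAB : Disjoint A B := by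
    rw [Finset.disjoint_left]
    simp only [A, B, Finset.mem_image, not_exists, not_and]
    rintro _ ⟨S, -, rfl⟩ S' - h
    have : none ∈ Finset.insertNone S' := by simp
    rw [h] at this
    simp at this
  have hB : B.card = d.choose k := by
    rw [Finset.card_image_of_injective _ Finset.insertNone.injective, Finset.card_powersetCard,
      Finset.card_erase_of_mem (Finset.mem_univ _), Finset.card_univ, Fintype.card_fin]
    rfl
  have hA : (d + 1).choose (k + 1) < A.card + d.choose k := by
    rw [Finset.card_image_of_injective _ (Finset.map_injective _)]
    have hc : (Finset.powersetCard (k + 1) (Finset.univ : Finset (Fin (d + 1)))).card =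
        (d + 1).choose (k + 1) := by simp
    by_cases hkd : k + 1 = d
    · have := Finset.pred_card_le_card_erase
        (s := Finset.powersetCard (k + 1) (Finset.univ : Finset (Fin (d + 1))))
        (a := Finset.univ.erase (Fin.last d))
      have h2 : d.choose k = d := by
        subst hkd
        exact Nat.choose_succ_self_right k
      omega
    · rw [Finset.erase_eq_of_notMem, hc]
      · have := Nat.choose_pos hk.le
        omega
      · rw [Finset.mem_powersetCard, Finset.card_erase_of_mem (Finset.mem_univ _),
          Finset.card_univ, Fintype.card_fin]
        omega
  rw [← hB, ← Finset.card_union_of_disjoint hAB, ← Set.ncard_coe_finset] at hA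
  refine hA.trans_le (Set.ncard_le_ncard ?_ (Set.toFinite _))
  intro T hT
  rw [Finset.mem_coe, Finset.mem_union] at hT
  rcases hT with hT | hT
  · obtain ⟨S, hS, rfl⟩ := Finset.mem_image.1 hT
    rw [Finset.mem_erase, Finset.mem_powersetCard] at hS
    refine ⟨⟨Or.inl (by simp), ?_⟩, by simpa using hS.2.2⟩
    by_contra! hcon
    have hsub : Finset.univ.erase (Fin.last d) ⊆ S := by
      intro j hj
      simpa using hcon j (Finset.ne_of_mem_erase hj)
    have h0 : Fin.last d ∈ S := by
      by_contra h0
      refine hS.1 (Finset.Subset.antisymm (fun j hj => ?_) hsub)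
      exact Finset.mem_erase.2 ⟨fun h => h0 (h ▸ hj), Finset.mem_univ _⟩
    have : S = Finset.univ := by
      ext j
      by_cases hj : j = Fin.last d
      · simp [hj, h0]
      · simpa using hsub (Finset.mem_erase.2 ⟨hj, Finset.mem_univ _⟩)
    have h2 := hS.2.2
    rw [this, Finset.card_univ, Fintype.card_fin] at h2
    omega
  · obtain ⟨S, hS, rfl⟩ := Finset.mem_image.1 hT
    rw [Finset.mem_powersetCard] at hS
    refine ⟨⟨Or.inr fun h => ?_, ?_⟩, by simp [hS.2]⟩
    · have := hS.1 (Finset.some_mem_insertNone.1 h)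
      simp at this
    · by_contra! hcon
      have hsub : Finset.univ.erase (Fin.last d) ⊆ S := by
        intro j hj
        simpa using hcon j (Finset.ne_of_mem_erase hj)
      have := Finset.card_le_card hsub
      rw [Finset.card_erase_of_mem (Finset.mem_univ _), Finset.card_univ, Fintype.card_fin,
        hS.2] at this
      omega

/-- If one generator lies beyond exactly one facet of a simplicial cone and all others are inside
it, every face of the bipyramid is a face of the cone of the generators. -/
theorem choose_lt_ncard_exposed {d : ℕ} {ι E : Type*} [Fintype ι] [NormedAddCommGroup E]
    [InnerProductSpace ℝ E] [FiniteDimensional ℝ E] {x : ι → E} {σ : Option (Fin (d + 1)) ↪ ι}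
    (hli : LinearIndependent ℝ fun j => x (σ (some j)))
    {c : Fin (d + 1) → ℝ} (hc0 : c (Fin.last d) < 0) (hc : ∀ j, j ≠ Fin.last d → 0 < c j)
    (hq : x (σ none) = ∑ j, c j • x (σ (some j)))
    (hpos : ∀ i ∉ Set.range σ, ∃ c : Fin (d + 1) → ℝ, (∀ j, 0 < c j) ∧
      x i = ∑ j, c j • x (σ (some j)))
    {k : ℕ} (hd : 2 ≤ d) (hk : k < d) :
    (d + 1).choose (k + 1) <
      {T : Finset ι | IsExposedIndexSet x T ∧
        Module.finrank ℝ (Submodule.span ℝ (x '' T)) = k + 1}.ncard := by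
  classical
  refine (choose_lt_ncard_isBipyramidFace hd hk).trans_le ?_
  rw [← Set.InjOn.ncard_image (f := Finset.map σ) (Finset.map_injective σ).injOn]
  refine Set.ncard_le_ncard ?_ (Set.toFinite _)
  rintro _ ⟨S, ⟨⟨hS1, j₀, hj₀, hjS⟩, hcard⟩, rfl⟩
  constructor
  · -- The functional has value `1` at the vertices of the simplex outside `S`; its value at the
    -- apex `some (Fin.last d)` then decides its sign at the other apex.
    let a : ℝ := ∑ j ∈ Finset.univ.erase (Fin.last d), c j * (if some j ∈ S then 0 else 1)
    have ha : 0 < a := by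
      apply Finset.sum_pos'
      · intro j hj
        have := hc j (Finset.ne_of_mem_erase hj)
        split_ifs <;> simp [this.le]
      · exact ⟨j₀, Finset.mem_erase.2 ⟨hj₀, Finset.mem_univ _⟩, by simp [hjS, hc j₀ hj₀]⟩
    let t : ℝ := if some (Fin.last d) ∈ S then 0 else
      if none ∈ S then a / (-c (Fin.last d)) else a / (2 * -c (Fin.last d))
    let s : Fin (d + 1) → ℝ := fun j => if j = Fin.last d then t else if some j ∈ S then 0 else 1
    obtain ⟨u, hu⟩ := hli.exists_inner_eq s
    have hc0' : 0 < -c (Fin.last d) := by linarith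
    have hs0 : ∀ j, some j ∈ S → s j = 0 := by
      intro j hj
      by_cases h0 : j = Fin.last d
      · subst h0
        simp [s, t, hj]
      · simp [s, h0, hj]
    have hs1 : ∀ j, some j ∉ S → 0 < s j := by
      intro j hj
      by_cases h0 : j = Fin.last d
      · subst h0
        simp only [s, t, hj, if_true, if_false]
        split_ifs <;> positivity
      · simp [s, h0, hj]
    have hqv : inner ℝ u (x (σ none)) = c (Fin.last d) * t + a := by
      rw [hq, inner_sum, ← Finset.add_sum_erase _ _ (Finset.mem_univ (Fin.last d))]
      simp only [inner_smul_right, hu]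
      refine congrArg₂ (· + ·) (by simp [s]) (Finset.sum_congr rfl fun j hj => ?_)
      simp [s, Finset.ne_of_mem_erase hj]
    have hc0n : c (Fin.last d) ≠ 0 := hc0.ne
    refine ⟨u, ?_, ?_⟩
    · intro i hi
      obtain ⟨o, ho, rfl⟩ := Finset.mem_map.1 hi
      rcases o with _ | j
      · have h0 : some (Fin.last d) ∉ S := hS1.resolve_left (not_not.2 ho)
        rw [hqv]
        simp only [t, h0, ho, if_true, if_false]
        field_simp
        ring
      · rw [hu, hs0 j ho]
    · intro i hi
      by_cases hir : i ∈ Set.range σ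
      · obtain ⟨o, rfl⟩ := hir
        have ho : o ∉ S := fun h => hi (Finset.mem_map_of_mem _ h)
        rcases o with _ | j
        · rw [hqv]
          simp only [t, ho, if_false]
          split_ifs
          · simpa using ha
          · have : c (Fin.last d) * (a / (2 * -c (Fin.last d))) + a = a / 2 := by field_simp; ring
            rw [this]
            positivity
        · rw [hu]
          exact hs1 j ho
      · obtain ⟨b, hb, hxi⟩ := hpos i hir
        rw [hxi, inner_sum]
        simp only [inner_smul_right, hu]
        apply Finset.sum_pos'
        · intro j _
          refine mul_nonneg (hb j).le ?_
          by_cases hj : some j ∈ S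
          · exact (hs0 j hj).ge
          · exact (hs1 j hj).le
        · exact ⟨j₀, Finset.mem_univ _, mul_pos (hb j₀) (hs1 j₀ hjS)⟩
  · have hind : LinearIndepOn ℝ (fun o => x (σ o)) (S : Set (Option (Fin (d + 1)))) := by
      rw [linearIndepOn_finset_iff]
      intro g hg
      have hu : ∀ l, ∃ u : E, ∀ j, inner ℝ u (x (σ (some j))) = if j = l then 1 else 0 :=
        fun l => hli.exists_inner_eq _
      have hval : ∀ l, (if none ∈ S then g none * c l else 0) +
          (if some l ∈ S then g (some l) else 0) = 0 := by
        intro l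
        obtain ⟨u, hu⟩ := hu l
        have hun : inner ℝ u (x (σ none)) = c l := by
          rw [hq, inner_sum]
          simp [inner_smul_right, hu]
        have h3 : ∀ o ∈ S, inner ℝ u (g o • x (σ o)) =
            (if o = none then g none * c l else 0) + if o = some l then g (some l) else 0 := by
          intro o _
          rcases o with _ | j
          · simp [inner_smul_right, hun]
          · rw [inner_smul_right, hu]
            by_cases hjl : j = l
            · simp [hjl]
            · simp [hjl]
        have := congrArg (inner ℝ u) hg
        rwa [inner_sum, inner_zero_right, Finset.sum_congr rfl h3, Finset.sum_add_distrib,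
          Finset.sum_ite_eq', Finset.sum_ite_eq'] at this
      have hnone : none ∈ S → g none = 0 := by
        intro h
        have := hval j₀
        simpa [h, hjS, (hc j₀ hj₀).ne'] using this
      intro o ho
      rcases o with _ | l
      · exact hnone ho
      · have := hval l
        by_cases h : none ∈ S
        · simpa [h, ho, hnone h] using this
        · simpa [h, ho] using this
    have hind' : LinearIndependent ℝ fun o : S => x (σ o) := hind
    have hset : (Set.range fun o : S => x (σ o)) = x '' (S.map σ) := by
      ext y
      simp
    rw [← hset, finrank_span_eq_card hind', Fintype.card_coe, hcard]

/-! ### Independent points hitting prescribed cells -/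

theorem descFactorial_mul_le_prob_exists_embedding {Ω S J : Type*} [MeasurableSpace Ω]
    [MeasurableSpace S] [Fintype J] {n : ℕ} {P : Measure Ω} {μ : Measure S}
    {X : Fin n → Ω → S} (hind : iIndepFun X P) (hlaw : ∀ i, HasLaw (X i) μ P)
    {B : J → Set S} (hB : ∀ j, MeasurableSet (B j)) {I : Set S} (hI : MeasurableSet I)
    (hdisj : ∀ j j', j ≠ j' → Disjoint (B j) (B j')) (hBI : ∀ j, Disjoint (B j) I)
    {a : ENNReal} (ha : ∀ j, a ≤ μ (B j)) :
    n.descFactorial (Fintype.card J) * (a ^ Fintype.card J * μ I ^ (n - Fintype.card J)) ≤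
      P {ω | ∃ σ : J ↪ Fin n, (∀ j, X (σ j) ω ∈ B j) ∧ ∀ i ∉ Set.range σ, X i ω ∈ I} := by
  classical
  let C : (J ↪ Fin n) → Fin n → Set S := fun σ => Function.extend σ B fun _ => I
  have hCσ : ∀ (σ : J ↪ Fin n) j, C σ (σ j) = B j := fun σ j => σ.injective.extend_apply _ _ j
  have hCn : ∀ (σ : J ↪ Fin n) i, i ∉ Set.range σ → C σ i = I := fun σ i hi =>
    Function.extend_apply' _ _ _ (by simpa using hi)
  have hC : ∀ σ i, MeasurableSet (C σ i) := by
    intro σ i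
    by_cases hi : i ∈ Set.range σ
    · obtain ⟨j, rfl⟩ := hi
      rw [hCσ]; exact hB j
    · rw [hCn σ i hi]; exact hI
  let F : (J ↪ Fin n) → Set Ω := fun σ => ⋂ i ∈ (Finset.univ : Finset (Fin n)), X i ⁻¹' C σ i
  have hF : ∀ σ ω, ω ∈ F σ ↔ (∀ j, X (σ j) ω ∈ B j) ∧ ∀ i ∉ Set.range σ, X i ω ∈ I := by
    intro σ ω
    simp only [F, Finset.mem_univ, Set.iInter_true, Set.mem_iInter, Set.mem_preimage]
    constructor
    · intro h
      exact ⟨fun j => hCσ σ j ▸ h (σ j), fun i hi => hCn σ i hi ▸ h i⟩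
    · rintro ⟨h1, h2⟩ i
      by_cases hi : i ∈ Set.range σ
      · obtain ⟨j, rfl⟩ := hi
        rw [hCσ]; exact h1 j
      · rw [hCn σ i hi]; exact h2 i hi
  have hset : {ω | ∃ σ : J ↪ Fin n, (∀ j, X (σ j) ω ∈ B j) ∧ ∀ i ∉ Set.range σ, X i ω ∈ I} =
      ⋃ σ, F σ := by
    ext ω
    simp only [Set.mem_iUnion, hF]
    rfl
  have hFdisj : Pairwise (Function.onFun (AEDisjoint P) F) := by
    intro σ τ hστ
    apply Disjoint.aedisjoint
    rw [Set.disjoint_left]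
    intro ω h1 h2
    rw [hF] at h1 h2
    apply hστ
    ext1 j
    by_contra hne
    by_cases hr : σ j ∈ Set.range τ
    · obtain ⟨l, hl⟩ := hr
      have hlj : l ≠ j := by
        rintro rfl
        exact hne hl.symm
      exact Set.disjoint_left.1 (hdisj l j hlj) (h2.1 l) (hl ▸ h1.1 j)
    · exact Set.disjoint_left.1 (hBI j) (h1.1 j) (h2.2 _ hr)
  have hFmeas : ∀ σ, NullMeasurableSet (F σ) P := fun σ =>
    Finset.nullMeasurableSet_biInter _ fun i _ =>
      (hlaw i).aemeasurable.nullMeasurableSet_preimage (hC σ i)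
  have hPF : ∀ σ, a ^ Fintype.card J * μ I ^ (n - Fintype.card J) ≤ P (F σ) := by
    intro σ
    rw [hind.measure_inter_preimage_eq_mul Finset.univ (fun i _ => hC σ i)]
    have h1 : ∀ i, P (X i ⁻¹' C σ i) = μ (C σ i) := fun i => by
      rw [← (hlaw i).map_eq, Measure.map_apply_of_aemeasurable (hlaw i).aemeasurable (hC σ i)]
    have h2 : ∏ i, (if i ∈ Finset.univ.map σ then a else μ I) =
        a ^ Fintype.card J * μ I ^ (n - Fintype.card J) := by
      rw [Finset.prod_ite, Finset.prod_const, Finset.prod_const, Finset.filter_mem_eq_inter,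
        Finset.univ_inter, Finset.card_map, Finset.filter_notMem_eq_sdiff,
        Finset.card_sdiff_of_subset (Finset.subset_univ _), Finset.card_map]
      simp
    rw [← h2]
    refine Finset.prod_le_prod' fun i _ => ?_
    rw [h1]
    split_ifs with hi
    · obtain ⟨j, -, rfl⟩ := Finset.mem_map.1 hi
      rw [hCσ]; exact ha j
    · rw [hCn σ i (by simpa using hi)]
  rw [hset, measure_iUnion₀ hFdisj hFmeas, tsum_fintype]
  calc _ = ∑ _σ : J ↪ Fin n, (a ^ Fintype.card J * μ I ^ (n - Fintype.card J)) := by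
        simp [Finset.card_univ, Fintype.card_embedding_eq]
    _ ≤ _ := Finset.sum_le_sum fun σ _ => hPF σ

/-- If each cell has probability of order `1 / n` and the complement of the region `I` has
probability at most `1 / (2 * n)`, then with probability bounded away from zero each cell contains
exactly one of `n` independent points and all other points lie in `I`. -/
theorem le_prob_exists_embedding {Ω S J : Type*} [MeasurableSpace Ω]
    [MeasurableSpace S] [Fintype J] [Nonempty J] {n : ℕ} (hn : Fintype.card J ≤ n)
    {P : Measure Ω} {μ : Measure S}
    {X : Fin n → Ω → S} (hind : iIndepFun X P) (hlaw : ∀ i, HasLaw (X i) μ P)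
    {B : J → Set S} (hB : ∀ j, MeasurableSet (B j)) {I : Set S} (hI : MeasurableSet I)
    (hdisj : ∀ j j', j ≠ j' → Disjoint (B j) (B j')) (hBI : ∀ j, Disjoint (B j) I)
    {a : ℝ} (ha0 : 0 ≤ a) (ha : ∀ j, ENNReal.ofReal (a / n) ≤ μ (B j))
    (hI2 : ENNReal.ofReal (1 - 1 / (2 * n)) ≤ μ I) :
    ENNReal.ofReal ((a / Fintype.card J) ^ Fintype.card J / 2) ≤
      P {ω | ∃ σ : J ↪ Fin n, (∀ j, X (σ j) ω ∈ B j) ∧ ∀ i ∉ Set.range σ, X i ω ∈ I} := by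
  refine le_trans ?_ (descFactorial_mul_le_prob_exists_embedding hind hlaw hB hI hdisj hBI ha)
  set m := Fintype.card J with hm
  have hm1 : 1 ≤ m := Fintype.card_pos
  have hn1 : (1 : ℝ) ≤ n := by exact_mod_cast hm1.trans hn
  have hm1' : (1 : ℝ) ≤ m := by exact_mod_cast hm1
  have hn0 : (0 : ℝ) < n := by linarith
  have hm0 : (0 : ℝ) < m := by linarith
  have hnm : (m : ℝ) ≤ n := by exact_mod_cast hn
  have hi0 : 0 ≤ 1 - 1 / (2 * (n : ℝ)) := by
    rw [sub_nonneg, div_le_one (by linarith)]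
    linarith
  have hi1 : 1 - 1 / (2 * (n : ℝ)) ≤ 1 := by
    have : 0 ≤ 1 / (2 * (n : ℝ)) := by positivity
    linarith
  have hbern : 1 / 2 ≤ (1 - 1 / (2 * (n : ℝ))) ^ (n - m) := by
    refine le_trans ?_ (pow_le_pow_of_le_one hi0 hi1 (Nat.sub_le n m))
    have h := one_add_mul_le_pow (a := -(1 / (2 * (n : ℝ)))) (by linarith) n
    rw [← sub_eq_add_neg] at h
    refine le_trans (le_of_eq ?_) h
    field_simp
    norm_num
  have hdesc : ((n : ℝ) / m) ^ m ≤ n.descFactorial m := by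
    have h1 : ((n + 1 - m : ℕ) : ℝ) ^ m ≤ n.descFactorial m := by
      exact_mod_cast Nat.pow_sub_le_descFactorial n m
    refine le_trans (pow_le_pow_left₀ (by positivity) ?_ m) h1
    rw [Nat.cast_sub (by omega), div_le_iff₀ hm0]
    push_cast
    nlinarith
  calc ENNReal.ofReal ((a / m) ^ m / 2)
      ≤ ENNReal.ofReal (n.descFactorial m * ((a / n) ^ m * (1 - 1 / (2 * (n : ℝ))) ^ (n - m))) := by
        apply ENNReal.ofReal_le_ofReal
        calc (a / m) ^ m / 2 = ((n : ℝ) / m) ^ m * ((a / n) ^ m * (1 / 2)) := by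
              rw [← mul_assoc, ← mul_pow]
              have : (n : ℝ) / m * (a / n) = a / m := by field_simp
              rw [this]
              ring
          _ ≤ _ := by gcongr
    _ = n.descFactorial m * (ENNReal.ofReal (a / n) ^ m *
          ENNReal.ofReal (1 - 1 / (2 * (n : ℝ))) ^ (n - m)) := by
        rw [ENNReal.ofReal_mul (by positivity), ENNReal.ofReal_mul (by positivity),
          ENNReal.ofReal_natCast, ENNReal.ofReal_pow (by positivity), ENNReal.ofReal_pow hi0]
    _ ≤ _ := by gcongr

/-- A random variable that takes values at most `m` and values at least `m + 1`, both with
probability at least `p`, has variance at least `p / 4`. -/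
theorem div_four_le_variance {Ω : Type*} [MeasurableSpace Ω] {P : Measure Ω}
    [IsProbabilityMeasure P] {f : Ω → ℝ} (hf : MemLp f 2 P) {m p : ℝ} {A B : Set Ω}
    (hA : ∀ ω ∈ A, f ω ≤ m) (hB : ∀ ω ∈ B, m + 1 ≤ f ω)
    (hPA : ENNReal.ofReal p ≤ P A) (hPB : ENNReal.ofReal p ≤ P B) :
    p / 4 ≤ Var[f; P] := by
  have hcheb := meas_ge_le_variance_div_sq hf (c := 1 / 2) (by norm_num)
  have hle : ENNReal.ofReal p ≤ P {ω | 1 / 2 ≤ |f ω - P[f]|} := by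
    rcases le_total (m + 1 / 2) (P[f]) with h | h
    · refine hPA.trans (measure_mono fun ω hω => ?_)
      have := hA ω hω
      refine le_trans (b := -(f ω - P[f])) ?_ (neg_le_abs _)
      linarith
    · refine hPB.trans (measure_mono fun ω hω => ?_)
      have := hB ω hω
      refine le_trans (b := f ω - P[f]) ?_ (le_abs_self _)
      linarith
  have h := hle.trans hcheb
  have hv := variance_nonneg f P
  rw [ENNReal.ofReal_le_ofReal_iff (by positivity)] at h
  norm_num at h
  linarith

/-! ### The hemisphere law as a ratio of volumes of cones -/

noncomputable section

/-- The function `x_{d+1} ^ α` on the upper half space, extended by zero. -/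
def halfSpaceDensity (d : ℕ) (α : ℝ) (x : EuclideanSpace ℝ (Fin (d + 1))) : ENNReal :=
  if 0 < x (Fin.last d) then ENNReal.ofReal (x (Fin.last d) ^ α) else 0

/-- The measure on `ℝ^(d+1)` with density `x_{d+1} ^ α` on the upper half space. -/
def halfSpaceWeight (d : ℕ) (α : ℝ) : Measure (EuclideanSpace ℝ (Fin (d + 1))) :=
  volume.withDensity (halfSpaceDensity d α)

theorem measurable_halfSpaceDensity (d : ℕ) (α : ℝ) : Measurable (halfSpaceDensity d α) := by
  refine Measurable.ite (measurableSet_lt measurable_const (by fun_prop)) ?_ measurable_const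
  exact ENNReal.measurable_ofReal.comp (Measurable.pow_const (by fun_prop) _)

theorem halfSpaceWeight_apply {d : ℕ} {α : ℝ} {M : Set (EuclideanSpace ℝ (Fin (d + 1)))}
    (hM : MeasurableSet M) :
    halfSpaceWeight d α M = ∫⁻ x, M.indicator (halfSpaceDensity d α) x := by
  rw [halfSpaceWeight, withDensity_apply _ hM, lintegral_indicator hM]

theorem halfSpaceDensity_smul {d : ℕ} {α r : ℝ} (hr : 0 < r)
    (x : EuclideanSpace ℝ (Fin (d + 1))) :
    halfSpaceDensity d α (r • x) = halfSpaceDensity d α x * ENNReal.ofReal (r ^ α) := by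
  simp only [halfSpaceDensity, PiLp.smul_apply, smul_eq_mul, mul_pos_iff_of_pos_left hr]
  split_ifs with h
  · rw [Real.mul_rpow hr.le h.le, ENNReal.ofReal_mul (by positivity), mul_comm]
  · simp

theorem halfSpaceWeight_pos {d : ℕ} {α : ℝ} {U : Set (EuclideanSpace ℝ (Fin (d + 1)))}
    (hU : IsOpen U) (hne : U.Nonempty) (hpos : ∀ x ∈ U, 0 < x (Fin.last d)) :
    0 < halfSpaceWeight d α U := by
  rw [halfSpaceWeight, withDensity_apply _ hU.measurableSet,
    setLIntegral_pos_iff (measurable_halfSpaceDensity d α)]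
  refine (hU.measure_pos volume hne).trans_le (measure_mono fun x hx => ⟨?_, hx⟩)
  have := hpos x hx
  simp [halfSpaceDensity, this, Real.rpow_pos_of_pos this]

theorem halfSpaceWeight_mono {d : ℕ} {α : ℝ} {M N : Set (EuclideanSpace ℝ (Fin (d + 1)))}
    (hM : MeasurableSet M) (hN : MeasurableSet N)
    (h : ∀ x ∈ M, 0 < x (Fin.last d) → x ∈ N) :
    halfSpaceWeight d α M ≤ halfSpaceWeight d α N := by
  classical
  rw [halfSpaceWeight_apply hM, halfSpaceWeight_apply hN]
  refine lintegral_mono fun x => ?_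
  by_cases hx : x ∈ M
  · by_cases h0 : 0 < x (Fin.last d)
    · simp [hx, h x hx h0]
    · simp [Set.indicator_apply, halfSpaceDensity, h0]
  · simp [hx]

/-- The weight of the unit cube is finite, as `t ^ α` is integrable at zero for `α > -1`. -/
theorem halfSpaceWeight_cube_lt_top (d : ℕ) {α : ℝ} (hα : -1 < α) :
    halfSpaceWeight d α {x | ∀ i, |x i| ≤ 1} < ⊤ := by
  have hQ : MeasurableSet {x : EuclideanSpace ℝ (Fin (d + 1)) | ∀ i, |x i| ≤ 1} := by
    rw [Set.ofPred_forall]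
    exact MeasurableSet.iInter fun i => measurableSet_le (by fun_prop) measurable_const
  let f : Fin (d + 1) → ℝ → ℝ := fun i => if i = Fin.last d then
    (Set.Ioo (0 : ℝ) 2).indicator (fun t => t ^ α) else (Set.Icc (-1 : ℝ) 1).indicator 1
  have hf : ∀ i, Integrable (f i) := by
    intro i
    simp only [f]
    split_ifs
    · exact (integrable_indicator_iff measurableSet_Ioo).2
        ((intervalIntegral.integrableOn_Ioo_rpow_iff (by norm_num)).2 hα)
    · refine (integrable_indicator_iff measurableSet_Icc).2 ?_
      exact integrableOn_const (by simp)
  have hint : Integrable fun x : Fin (d + 1) → ℝ => ∏ i, f i (x i) := Integrable.fintype_prod hf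
  have hint2 := (PiLp.volume_preserving_ofLp (Fin (d + 1))).integrable_comp_of_integrable hint
  rw [halfSpaceWeight_apply hQ]
  refine lt_of_le_of_lt (lintegral_mono fun x => ?_) hint2.hasFiniteIntegral
  by_cases hx : x ∈ {x : EuclideanSpace ℝ (Fin (d + 1)) | ∀ i, |x i| ≤ 1}
  · rw [Set.indicator_of_mem hx, halfSpaceDensity]
    split_ifs with h0
    · have hprod : ∏ i, f i (x i) = x (Fin.last d) ^ α := by
        rw [Finset.prod_eq_single (Fin.last d)]
        · have h2 : x (Fin.last d) < 2 := by
            have := (abs_le.1 (hx (Fin.last d))).2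
            linarith
          simp [f, h0, h2]
        · intro i _ hi
          simp only [f, hi, if_false]
          rw [Set.indicator_of_mem]
          · rfl
          · exact abs_le.1 (hx i)
        · simp
      simp only [Function.comp]
      rw [hprod, Real.enorm_eq_ofReal (by positivity)]
    · exact zero_le
  · rw [Set.indicator_of_notMem hx]
    exact zero_le

/-- Integration in polar coordinates: the weight of the part of a cone in the unit ball is a fixed
multiple of the weight of its trace on the sphere. -/
theorem exists_halfSpaceWeight_cone_eq (d : ℕ) (α : ℝ) :
    ∃ κ : ENNReal, ∀ (A : Set (UnitSphere d)) (C : Set (EuclideanSpace ℝ (Fin (d + 1)))),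
      MeasurableSet A → MeasurableSet C →
      (∀ (s : UnitSphere d) (r : ℝ), 0 < r →
        (r • (s : EuclideanSpace ℝ (Fin (d + 1))) ∈ C ↔ s ∈ A)) →
      halfSpaceWeight d α (C ∩ Metric.ball 0 1) = hemisphereWeight d α A * κ := by
  refine ⟨∫⁻ r : Set.Ioi (0 : ℝ), {r : Set.Ioi (0 : ℝ) | (r : ℝ) < 1}.indicator
    (fun r => ENNReal.ofReal ((r : ℝ) ^ α)) r ∂(Measure.volumeIoiPow
      (Module.finrank ℝ (EuclideanSpace ℝ (Fin (d + 1))) - 1)), ?_⟩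
  intro A C hA hC hCA
  have hCb : MeasurableSet (C ∩ Metric.ball 0 1) := hC.inter measurableSet_ball
  set G := (C ∩ Metric.ball 0 1).indicator (halfSpaceDensity d α) with hG
  have hH : MeasurableSet (openHemisphere d) :=
    measurableSet_lt measurable_const (by fun_prop)
  have hhemi : hemisphereWeight d α A = ∫⁻ s : UnitSphere d,
      A.indicator (fun s => halfSpaceDensity d α s) s ∂(volume.toSphere) := by
    rw [hemisphereWeight, withDensity_apply _ hA, Measure.restrict_restrict hA,
      ← lintegral_indicator (hA.inter hH)]
    refine lintegral_congr fun s => ?_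
    by_cases hs : s ∈ A
    · by_cases h0 : 0 < (s : EuclideanSpace ℝ (Fin (d + 1))) (Fin.last d)
      · have : s ∈ openHemisphere d := h0
        simp [hs, this, halfSpaceDensity, h0]
      · have : s ∉ openHemisphere d := h0
        simp [hs, this, halfSpaceDensity, h0]
    · simp [hs]
  have hsub : MeasurableSet ({0}ᶜ : Set (EuclideanSpace ℝ (Fin (d + 1)))) :=
    (measurableSet_singleton _).compl
  have h0 : ∫⁻ x, G x = ∫⁻ x in ({0}ᶜ : Set (EuclideanSpace ℝ (Fin (d + 1)))), G x := by
    rw [Measure.restrict_congr_set (t := Set.univ), Measure.restrict_univ]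
    rw [ae_eq_univ, compl_compl]
    exact measure_singleton 0
  have hmp := (Measure.measurePreserving_homeomorphUnitSphereProd
    (volume : Measure (EuclideanSpace ℝ (Fin (d + 1))))).symm
      (homeomorphUnitSphereProd _).toMeasurableEquiv
  rw [halfSpaceWeight_apply hCb, ← hG, h0, ← lintegral_subtype_comap hsub,
    ← hmp.lintegral_comp_emb (MeasurableEquiv.measurableEmbedding _), hhemi,
    ← lintegral_prod_mul]
  · classical
    refine lintegral_congr fun p => ?_
    obtain ⟨s, r, hr⟩ := p
    have hr : 0 < r := hr
    change G (r • (s : EuclideanSpace ℝ (Fin (d + 1)))) = _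
    have hball : r • (s : EuclideanSpace ℝ (Fin (d + 1))) ∈ Metric.ball 0 1 ↔ r < 1 := by
      rw [mem_ball_zero_iff, norm_smul, norm_eq_of_mem_sphere, mul_one,
        Real.norm_of_nonneg hr.le]
    simp only [hG, Set.indicator_apply, Set.mem_inter_iff, hCA s r hr, hball, Set.mem_ofPred_eq,
      halfSpaceDensity_smul hr]
    by_cases h1 : s ∈ A <;> by_cases h2 : r < 1 <;> simp [h1, h2]
  · exact (((measurable_halfSpaceDensity d α).comp measurable_subtype_coe).indicator
      hA).aemeasurable
  · refine Measurable.aemeasurable (Measurable.indicator ?_ ?_)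
    · exact ENNReal.measurable_ofReal.comp (Measurable.pow_const (by fun_prop) _)
    · exact measurableSet_lt (by fun_prop) measurable_const

theorem halfSpaceWeight_ball_pos (d : ℕ) (α : ℝ) :
    0 < halfSpaceWeight d α (Metric.ball 0 1) := by
  refine (halfSpaceWeight_pos (U := Metric.ball 0 1 ∩ {x | 0 < x (Fin.last d)})
    (Metric.isOpen_ball.inter (isOpen_lt continuous_const (by fun_prop))) ?_
    fun x hx => hx.2).trans_le (measure_mono Set.inter_subset_left)
  refine ⟨EuclideanSpace.single (Fin.last d) (1 / 2), ?_, ?_⟩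
  · rw [mem_ball_zero_iff, PiLp.norm_single]
    norm_num
  · simp

theorem halfSpaceWeight_ball_lt_top (d : ℕ) {α : ℝ} (hα : -1 < α) :
    halfSpaceWeight d α (Metric.ball 0 1) < ⊤ := by
  refine (measure_mono fun x hx i => ?_).trans_lt (halfSpaceWeight_cube_lt_top d hα)
  exact (PiLp.norm_apply_le x i).trans (mem_ball_zero_iff.1 hx).le

theorem hemisphereLaw_eq_div {d : ℕ} {α : ℝ} (hα : -1 < α) {A : Set (UnitSphere d)}
    {C : Set (EuclideanSpace ℝ (Fin (d + 1)))} (hA : MeasurableSet A) (hC : MeasurableSet C)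
    (hCA : ∀ (s : UnitSphere d) (r : ℝ), 0 < r →
        (r • (s : EuclideanSpace ℝ (Fin (d + 1))) ∈ C ↔ s ∈ A)) :
    hemisphereLaw d α A =
      halfSpaceWeight d α (C ∩ Metric.ball 0 1) / halfSpaceWeight d α (Metric.ball 0 1) := by
  obtain ⟨κ, hκ⟩ := exists_halfSpaceWeight_cone_eq d α
  have hu := hκ Set.univ Set.univ .univ .univ (by simp)
  rw [Set.univ_inter] at hu
  have hpos := halfSpaceWeight_ball_pos d α
  have hfin := halfSpaceWeight_ball_lt_top d hα
  rw [hu] at hpos hfin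
  have hW0 : hemisphereWeight d α Set.univ ≠ 0 := fun h => by simp [h] at hpos
  have hκ0 : κ ≠ 0 := fun h => by simp [h] at hpos
  have hκt : κ ≠ ⊤ := fun h => by simp [h, hW0] at hfin
  rw [hκ A C hA hC hCA, hu, ENNReal.mul_div_mul_right _ _ hκ0 hκt, hemisphereLaw,
    Measure.smul_apply, smul_eq_mul, ENNReal.div_eq_inv_mul]

theorem isProbabilityMeasure_hemisphereLaw (d : ℕ) {α : ℝ} (hα : -1 < α) :
    IsProbabilityMeasure (hemisphereLaw d α) := by
  constructor
  rw [hemisphereLaw_eq_div hα .univ .univ (by simp), Set.univ_inter,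
    ENNReal.div_self (halfSpaceWeight_ball_pos d α).ne' (halfSpaceWeight_ball_lt_top d hα).ne]

/-! ### Scaling the last coordinate -/

/-- The linear map that multiplies the last coordinate by `ε`. -/
def scaleLast (d : ℕ) (ε : ℝ) :
    EuclideanSpace ℝ (Fin (d + 1)) →ₗ[ℝ] EuclideanSpace ℝ (Fin (d + 1)) :=
  LinearMap.transvection (EuclideanSpace.proj (𝕜 := ℝ) (Fin.last d)).toLinearMap
    (EuclideanSpace.single (Fin.last d) (ε - 1))

theorem scaleLast_apply_last {d : ℕ} (ε : ℝ) (x : EuclideanSpace ℝ (Fin (d + 1))) :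
    scaleLast d ε x (Fin.last d) = ε * x (Fin.last d) := by
  simp [scaleLast, LinearMap.transvection.apply]
  ring

theorem scaleLast_apply_of_ne {d : ℕ} (ε : ℝ) (x : EuclideanSpace ℝ (Fin (d + 1)))
    {i : Fin (d + 1)} (hi : i ≠ Fin.last d) : scaleLast d ε x i = x i := by
  simp [scaleLast, LinearMap.transvection.apply, hi]

theorem det_scaleLast (d : ℕ) (ε : ℝ) : LinearMap.det (scaleLast d ε) = ε := by
  simp [scaleLast, LinearMap.transvection.det]

theorem norm_scaleLast_le {d : ℕ} {ε : ℝ} (h0 : 0 ≤ ε) (h1 : ε ≤ 1)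
    (x : EuclideanSpace ℝ (Fin (d + 1))) : ‖scaleLast d ε x‖ ≤ ‖x‖ := by
  rw [← sq_le_sq₀ (norm_nonneg _) (norm_nonneg _), EuclideanSpace.norm_sq_eq,
    EuclideanSpace.norm_sq_eq]
  refine Finset.sum_le_sum fun i _ => ?_
  by_cases hi : i = Fin.last d
  · subst hi
    rw [scaleLast_apply_last, norm_mul, Real.norm_of_nonneg h0]
    exact pow_le_pow_left₀ (by positivity) (mul_le_of_le_one_left (norm_nonneg _) h1) 2
  · rw [scaleLast_apply_of_ne ε x hi]

theorem measurable_scaleLast (d : ℕ) (ε : ℝ) : Measurable (scaleLast d ε) :=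
  (LinearMap.continuous_of_finiteDimensional _).measurable

theorem halfSpaceWeight_eq_preimage_scaleLast {d : ℕ} {α ε : ℝ} (hε : 0 < ε)
    {M : Set (EuclideanSpace ℝ (Fin (d + 1)))} (hM : MeasurableSet M) :
    halfSpaceWeight d α M =
      ENNReal.ofReal (ε ^ (α + 1)) * halfSpaceWeight d α (scaleLast d ε ⁻¹' M) := by
  have hD := measurable_scaleLast d ε
  have hdens : ∀ x, (scaleLast d ε ⁻¹' M).indicator (halfSpaceDensity d α) x =
      ENNReal.ofReal (ε ^ (-α)) * M.indicator (halfSpaceDensity d α) (scaleLast d ε x) := by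
    intro x
    classical
    simp only [Set.indicator_apply, Set.mem_preimage]
    split_ifs with hx
    · simp only [halfSpaceDensity, scaleLast_apply_last, mul_pos_iff_of_pos_left hε]
      split_ifs with h
      · rw [← ENNReal.ofReal_mul (by positivity), Real.mul_rpow hε.le h.le, ← mul_assoc,
          ← Real.rpow_add hε]
        simp
      · simp
    · simp
  have hmap := Measure.map_linearMap_addHaar_eq_smul_addHaar
    (volume : Measure (EuclideanSpace ℝ (Fin (d + 1)))) (f := scaleLast d ε)
    (by rw [det_scaleLast]; exact hε.ne')
  have hmeas := (measurable_halfSpaceDensity d α).indicator hM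
  rw [halfSpaceWeight_apply hM, halfSpaceWeight_apply (hD hM), lintegral_congr hdens,
    lintegral_const_mul _ (by exact hmeas.comp hD), ← lintegral_map hmeas hD, hmap, det_scaleLast,
    lintegral_smul_measure, smul_eq_mul, ← mul_assoc, ← mul_assoc,
    ← ENNReal.ofReal_mul (by positivity), ← ENNReal.ofReal_mul (by positivity),
    ← Real.rpow_add hε, abs_of_pos (by positivity)]
  have : ε ^ (α + 1 + -α) * ε⁻¹ = 1 := by
    rw [show α + 1 + -α = 1 by ring, Real.rpow_one, mul_inv_cancel₀ hε.ne']
  rw [this, ENNReal.ofReal_one, one_mul]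

end

/-! ### Gnomonic cells -/

noncomputable section

/-- The gnomonic projection of the upper half space to the hyperplane `x_{d+1} = 1`, followed by
scaling that hyperplane by `ε`. -/
def gnomonic {d : ℕ} (ε : ℝ) (x : EuclideanSpace ℝ (Fin (d + 1))) : Fin (d + 1) → ℝ :=
  fun i => if i = Fin.last d then 1 else ε * x i / x (Fin.last d)

/-- The cone of the points of the upper half space whose scaled gnomonic projection lies in `M`. -/
def gnomonicCone (d : ℕ) (ε : ℝ) (M : Set (Fin (d + 1) → ℝ)) :
    Set (EuclideanSpace ℝ (Fin (d + 1))) :=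
  {x | 0 < x (Fin.last d) ∧ gnomonic ε x ∈ M}

/-- The points of the open hemisphere whose scaled gnomonic projection lies in `M`. -/
def gnomonicCell (d : ℕ) (ε : ℝ) (M : Set (Fin (d + 1) → ℝ)) : Set (UnitSphere d) :=
  {s | (s : EuclideanSpace ℝ (Fin (d + 1))) ∈ gnomonicCone d ε M}

theorem measurable_gnomonic {d : ℕ} (ε : ℝ) :
    Measurable (gnomonic ε : EuclideanSpace ℝ (Fin (d + 1)) → Fin (d + 1) → ℝ) := by
  refine measurable_pi_lambda _ fun i => ?_
  unfold gnomonic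
  split_ifs
  · exact measurable_const
  · fun_prop

theorem measurableSet_gnomonicCone {d : ℕ} (ε : ℝ) {M : Set (Fin (d + 1) → ℝ)}
    (hM : MeasurableSet M) : MeasurableSet (gnomonicCone d ε M) := by
  have h : gnomonicCone d ε M = {x | 0 < x (Fin.last d)} ∩ gnomonic ε ⁻¹' M := rfl
  rw [h]
  exact (measurableSet_lt measurable_const (by fun_prop)).inter (measurable_gnomonic ε hM)

theorem measurableSet_gnomonicCell {d : ℕ} (ε : ℝ) {M : Set (Fin (d + 1) → ℝ)}
    (hM : MeasurableSet M) : MeasurableSet (gnomonicCell d ε M) :=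
  measurable_subtype_coe (measurableSet_gnomonicCone ε hM)

theorem gnomonicCell_disjoint {d : ℕ} (ε : ℝ) {M N : Set (Fin (d + 1) → ℝ)}
    (h : Disjoint M N) : Disjoint (gnomonicCell d ε M) (gnomonicCell d ε N) :=
  Set.disjoint_left.2 fun _ h1 h2 => Set.disjoint_left.1 h h1.2 h2.2

theorem smul_mem_gnomonicCone_iff {d : ℕ} {ε r : ℝ} (hr : 0 < r) {M : Set (Fin (d + 1) → ℝ)}
    {x : EuclideanSpace ℝ (Fin (d + 1))} :
    r • x ∈ gnomonicCone d ε M ↔ x ∈ gnomonicCone d ε M := by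
  have h : gnomonic ε (r • x) = gnomonic ε x := by
    funext i
    simp only [gnomonic, PiLp.smul_apply, smul_eq_mul]
    rw [mul_left_comm, mul_div_mul_left _ _ hr.ne']
  simp [gnomonicCone, h, hr]

theorem scaleLast_mem_gnomonicCone_iff {d : ℕ} {ε : ℝ} (hε : 0 < ε) {M : Set (Fin (d + 1) → ℝ)}
    {x : EuclideanSpace ℝ (Fin (d + 1))} :
    scaleLast d ε x ∈ gnomonicCone d ε M ↔ x ∈ gnomonicCone d 1 M := by
  have h : gnomonic ε (scaleLast d ε x) = gnomonic 1 x := by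
    funext i
    by_cases hi : i = Fin.last d
    · simp [gnomonic, hi]
    · simp only [gnomonic, hi, if_false]
      rw [scaleLast_apply_last, scaleLast_apply_of_ne ε x hi, mul_div_mul_left _ _ hε.ne', one_mul]
  simp [gnomonicCone, h, scaleLast_apply_last, hε]

/-- Points of the half space are recovered from their gnomonic projection up to a positive factor
by a linear map. -/
theorem eq_smul_scaleLast_gnomonic {d : ℕ} {ε : ℝ} (hε : 0 < ε)
    {x : EuclideanSpace ℝ (Fin (d + 1))} (hx : 0 < x (Fin.last d)) :
    x = (x (Fin.last d) / ε) • scaleLast d ε (WithLp.toLp 2 (gnomonic ε x)) := by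
  ext i
  rw [PiLp.smul_apply, smul_eq_mul]
  by_cases hi : i = Fin.last d
  · subst hi
    rw [scaleLast_apply_last]
    simp [gnomonic]
    field_simp
  · rw [scaleLast_apply_of_ne ε _ hi]
    simp [gnomonic, hi]
    field_simp

theorem isOpen_gnomonicCone {d : ℕ} (ε : ℝ) {M : Set (Fin (d + 1) → ℝ)} (hM : IsOpen M) :
    IsOpen (gnomonicCone d ε M) := by
  have h : gnomonicCone d ε M = {x | 0 < x (Fin.last d)} ∩ gnomonic ε ⁻¹' M := rfl
  rw [h]
  refine ContinuousOn.isOpen_inter_preimage ?_ (isOpen_lt continuous_const (by fun_prop)) hM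
  refine continuousOn_pi.2 fun i => ?_
  unfold gnomonic
  split_ifs
  · exact continuousOn_const
  · exact ContinuousOn.div (by fun_prop) (by fun_prop) fun x hx => ne_of_gt hx

/-- A cell around a fixed point of the projection has probability at least of order
`ε ^ (α + 1)`. -/
theorem exists_le_hemisphereLaw_gnomonicCell {d : ℕ} {α : ℝ} (hα : -1 < α)
    {M : Set (Fin (d + 1) → ℝ)} (hM : IsOpen M) {w : Fin (d + 1) → ℝ} (hw : w ∈ M)
    (hw1 : w (Fin.last d) = 1) :
    ∃ a : ℝ, 0 < a ∧ ∀ ε : ℝ, 0 < ε → ε ≤ 1 →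
      ENNReal.ofReal (a * ε ^ (α + 1)) ≤ hemisphereLaw d α (gnomonicCell d ε M) := by
  have hb0 := halfSpaceWeight_ball_pos d α
  have hbt := halfSpaceWeight_ball_lt_top d hα
  set r := halfSpaceWeight d α (gnomonicCone d 1 M ∩ Metric.ball 0 1) with hr
  have hrpos : 0 < r := by
    refine halfSpaceWeight_pos ((isOpen_gnomonicCone 1 hM).inter Metric.isOpen_ball) ?_
      fun x hx => hx.1.1
    -- The point over `w`, shrunk into the unit ball.
    let v : EuclideanSpace ℝ (Fin (d + 1)) := WithLp.toLp 2 w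
    have hv : v ∈ gnomonicCone d 1 M := by
      have hlast : v (Fin.last d) = 1 := hw1
      refine ⟨by rw [hlast]; exact one_pos, ?_⟩
      convert hw using 1
      funext i
      by_cases hi : i = Fin.last d
      · simp [gnomonic, hi, hw1]
      · simp [gnomonic, hi, v, hw1]
    have hpos : 0 < (‖v‖ + 1)⁻¹ := by positivity
    refine ⟨(‖v‖ + 1)⁻¹ • v, (smul_mem_gnomonicCone_iff hpos).2 hv, ?_⟩
    rw [mem_ball_zero_iff, norm_smul, Real.norm_of_nonneg hpos.le, inv_mul_lt_iff₀ (by positivity)]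
    linarith
  have hrt : r < ⊤ := (measure_mono Set.inter_subset_right).trans_lt hbt
  refine ⟨(r / halfSpaceWeight d α (Metric.ball 0 1)).toReal, ?_, fun ε hε hε1 => ?_⟩
  · exact ENNReal.toReal_pos (ENNReal.div_pos hrpos.ne' hbt.ne).ne'
      (ENNReal.div_lt_top hrt.ne hb0.ne').ne
  rw [hemisphereLaw_eq_div hα (measurableSet_gnomonicCell ε hM.measurableSet)
    (measurableSet_gnomonicCone ε hM.measurableSet) fun s r hr => smul_mem_gnomonicCone_iff hr,
    ENNReal.ofReal_mul ENNReal.toReal_nonneg,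
    ENNReal.ofReal_toReal (ENNReal.div_lt_top hrt.ne hb0.ne').ne,
    halfSpaceWeight_eq_preimage_scaleLast hε
      ((measurableSet_gnomonicCone ε hM.measurableSet).inter measurableSet_ball), mul_comm,
    ← mul_div_assoc]
  refine ENNReal.div_le_div_right (mul_le_mul_right (measure_mono ?_) _) _
  rintro x ⟨h1, h2⟩
  refine ⟨(scaleLast_mem_gnomonicCone_iff hε).2 h1, ?_⟩
  rw [mem_ball_zero_iff] at h2 ⊢
  exact (norm_scaleLast_le hε.le hε1 x).trans_lt h2

/-- The unit cube in the hyperplane `x_{d+1} = 1`. -/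
def unitCube (d : ℕ) : Set (Fin (d + 1) → ℝ) :=
  {x | x (Fin.last d) = 1 ∧ ∀ i, |x i| ≤ 1}

theorem isCompact_unitCube (d : ℕ) : IsCompact (unitCube d) := by
  refine (isCompact_closedBall (0 : Fin (d + 1) → ℝ) 1).of_isClosed_subset ?_ fun x hx => ?_
  · have h : unitCube d = {x | x (Fin.last d) = 1} ∩ ⋂ i, {x | |x i| ≤ 1} := by
      ext x
      simp [unitCube]
    rw [h]
    exact (isClosed_eq (by fun_prop) continuous_const).inter <|
      isClosed_iInter fun i => isClosed_le (by fun_prop) continuous_const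
  · rw [mem_closedBall_zero_iff, pi_norm_le_iff_of_nonneg zero_le_one]
    exact hx.2

/-- The points outside the cell of the unit cube have probability at most of order
`ε ^ (α + 1)`. -/
theorem exists_hemisphereLaw_compl_le {d : ℕ} {α : ℝ} (hα : -1 < α) :
    ∃ b : ℝ, 0 < b ∧ ∀ ε : ℝ, 0 < ε → ε ≤ 1 →
      hemisphereLaw d α (gnomonicCell d ε (unitCube d))ᶜ ≤ ENNReal.ofReal (b * ε ^ (α + 1)) := by
  have hb0 := halfSpaceWeight_ball_pos d α
  have hQ := halfSpaceWeight_cube_lt_top d hα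
  have hQm : MeasurableSet {x : EuclideanSpace ℝ (Fin (d + 1)) | ∀ i, |x i| ≤ 1} := by
    rw [Set.ofPred_forall]
    exact MeasurableSet.iInter fun i => measurableSet_le (by fun_prop) measurable_const
  have hcube := (isCompact_unitCube d).measurableSet
  have hbt :
      halfSpaceWeight d α {x | ∀ i, |x i| ≤ 1} / halfSpaceWeight d α (Metric.ball 0 1) ≠ ⊤ :=
    (ENNReal.div_lt_top hQ.ne hb0.ne').ne
  refine ⟨(halfSpaceWeight d α {x | ∀ i, |x i| ≤ 1} /
    halfSpaceWeight d α (Metric.ball 0 1)).toReal + 1,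
    add_pos_of_nonneg_of_pos ENNReal.toReal_nonneg one_pos, fun ε hε hε1 => ?_⟩
  calc hemisphereLaw d α (gnomonicCell d ε (unitCube d))ᶜ
      = halfSpaceWeight d α ((gnomonicCone d ε (unitCube d))ᶜ ∩ Metric.ball 0 1) /
          halfSpaceWeight d α (Metric.ball 0 1) :=
        hemisphereLaw_eq_div hα (measurableSet_gnomonicCell ε hcube).compl
          (measurableSet_gnomonicCone ε hcube).compl
          fun s r hr => not_congr (smul_mem_gnomonicCone_iff hr)
    _ ≤ ENNReal.ofReal (ε ^ (α + 1)) * halfSpaceWeight d α {x | ∀ i, |x i| ≤ 1} /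
          halfSpaceWeight d α (Metric.ball 0 1) := by
        rw [halfSpaceWeight_eq_preimage_scaleLast hε
          ((measurableSet_gnomonicCone ε hcube).compl.inter measurableSet_ball)]
        refine ENNReal.div_le_div_right (mul_le_mul_right (halfSpaceWeight_mono
          (measurable_scaleLast d ε
            ((measurableSet_gnomonicCone ε hcube).compl.inter measurableSet_ball)) hQm ?_) _) _
        rintro x ⟨h1, h2⟩ h0
        have h1 : x ∉ gnomonicCone d 1 (unitCube d) := fun h =>
          h1 ((scaleLast_mem_gnomonicCone_iff hε).2 h)
        have hle : ∀ i, i ≠ Fin.last d → |x i| ≤ 1 := by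
          intro i hi
          have := PiLp.norm_apply_le (scaleLast d ε x) i
          rw [scaleLast_apply_of_ne ε x hi] at this
          exact this.trans (mem_ball_zero_iff.1 h2).le
        intro i
        by_cases hi : i = Fin.last d
        · -- The projection leaves the cube in some coordinate, which bounds the height.
          subst hi
          by_contra hgt
          rw [abs_of_pos h0, not_le] at hgt
          refine h1 ⟨h0, by simp [gnomonic], fun i => ?_⟩
          by_cases hi : i = Fin.last d
          · simp [gnomonic, hi]
          · simp only [gnomonic, hi, if_false, one_mul]
            rw [abs_div, abs_of_pos h0, div_le_one h0]
            exact (hle i hi).trans hgt.le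
        · exact hle i hi
    _ ≤ _ := by
        rw [mul_div_assoc, mul_comm, ENNReal.ofReal_mul (by positivity)]
        gcongr
        rw [← ENNReal.ofReal_toReal hbt]
        apply ENNReal.ofReal_le_ofReal
        rw [ENNReal.toReal_ofReal ENNReal.toReal_nonneg]
        linarith

end

/-! ### A simplex and a point beyond one of its facets -/

noncomputable section

open scoped Matrix in
/-- The coefficients of `x` with respect to the rows of `w`, multiplied by the square of the
determinant. In this form they are polynomials in the entries of `w` and `x`, with the same
signs as the coefficients if `w` is invertible. -/
def scaledCoeff {ι : Type*} [Fintype ι] [DecidableEq ι] (w : ι → ι → ℝ) (x : ι → ℝ) : ι → ℝ :=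
  (Matrix.of w).det • (x ᵥ* (Matrix.of w).adjugate)

theorem sum_scaledCoeff_smul {ι : Type*} [Fintype ι] [DecidableEq ι] {w : ι → ι → ℝ}
    (hw : (Matrix.of w).det ≠ 0) (x : ι → ℝ) :
    x = ∑ j, (scaledCoeff w x j / (Matrix.of w).det ^ 2) • w j := by
  have h := Matrix.vecMul_vecMul x (Matrix.of w).adjugate (Matrix.of w)
  rw [Matrix.adjugate_mul, Matrix.vecMul_smul, Matrix.vecMul_one, Matrix.vecMul_eq_sum] at h
  have h2 : x = (Matrix.of w).det⁻¹ • (Matrix.of w).det • x := by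
    rw [smul_smul, inv_mul_cancel₀ hw, one_smul]
  conv_lhs => rw [h2, ← h, Finset.smul_sum]
  refine Finset.sum_congr rfl fun j _ => ?_
  rw [smul_smul]
  change _ • w j = _
  congr 1
  simp only [scaledCoeff, Pi.smul_apply, smul_eq_mul]
  field_simp

theorem scaledCoeff_eq {ι : Type*} [Fintype ι] [DecidableEq ι] {w : ι → ι → ℝ} {x c : ι → ℝ}
    (h : x = ∑ j, c j • w j) : scaledCoeff w x = (Matrix.of w).det ^ 2 • c := by
  have hx : x = Matrix.vecMul c (Matrix.of w) := by
    rw [Matrix.vecMul_eq_sum]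
    exact h
  rw [scaledCoeff, hx, Matrix.vecMul_vecMul, Matrix.mul_adjugate, Matrix.vecMul_smul,
    Matrix.vecMul_one, smul_smul, sq]

theorem continuous_scaledCoeff {ι : Type*} [Fintype ι] [DecidableEq ι] (j : ι) :
    Continuous fun p : (ι → ι → ℝ) × (ι → ℝ) => scaledCoeff p.1 p.2 j := by
  have hof : Continuous fun p : (ι → ι → ℝ) × (ι → ℝ) => Matrix.of p.1 := continuous_fst
  have h : Continuous fun p : (ι → ι → ℝ) × (ι → ℝ) => scaledCoeff p.1 p.2 :=
    hof.matrix_det.smul (continuous_snd.matrix_vecMul hof.matrix_adjugate)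
  exact (continuous_apply j).comp h

/-- The vertices, in the hyperplane `x_{d+1} = 1`, of a simplex around the unit cube; its facets lie
in the hyperplanes `x_i = -2` and `∑ x_i = d + 1`, where `i ≤ d`. -/
def simplexVertex (d : ℕ) (j : Fin (d + 1)) : Fin (d + 1) → ℝ :=
  fun i => if i = Fin.last d then 1 else if i = j then 3 * d - 1 else -2

/-- A point of the hyperplane `x_{d+1} = 1` beyond the facet of the simplex opposite to its last
vertex: the reflection of that vertex in the centre of the facet. -/
def beyondVertex (d : ℕ) : Fin (d + 1) → ℝ :=
  fun i => if i = Fin.last d then 1 else 4 + 2 / d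

/-- Barycentric coordinates with respect to the simplex. -/
def simplexCoeff (d : ℕ) (x : Fin (d + 1) → ℝ) (j : Fin (d + 1)) : ℝ :=
  if j = Fin.last d then
    x (Fin.last d) - ∑ i : Fin d, (x i.castSucc + 2 * x (Fin.last d)) / (3 * d + 1)
  else (x j + 2 * x (Fin.last d)) / (3 * d + 1)

theorem sum_simplexCoeff_smul (d : ℕ) (x : Fin (d + 1) → ℝ) :
    x = ∑ j, simplexCoeff d x j • simplexVertex d j := by
  have hsum : ∑ j, simplexCoeff d x j = x (Fin.last d) := by
    rw [Fin.sum_univ_castSucc]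
    simp [simplexCoeff, Fin.castSucc_ne_last]
  have hd : (0 : ℝ) < 3 * d + 1 := by positivity
  funext i
  rw [Finset.sum_apply]
  simp only [Pi.smul_apply, smul_eq_mul]
  by_cases hi : i = Fin.last d
  · simp [simplexVertex, hi, hsum]
  · have h : ∀ j, simplexCoeff d x j * simplexVertex d j i =
        simplexCoeff d x j * (-2) + if i = j then simplexCoeff d x j * (3 * d + 1) else 0 := by
      intro j
      simp only [simplexVertex, hi, if_false]
      split_ifs <;> ring
    rw [Finset.sum_congr rfl fun j _ => h j, Finset.sum_add_distrib, ← Finset.sum_mul, hsum,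
      Finset.sum_ite_eq Finset.univ i]
    simp only [Finset.mem_univ, if_true, simplexCoeff, hi, if_false]
    field_simp
    ring

theorem det_simplexVertex_ne_zero (d : ℕ) : (Matrix.of (simplexVertex d)).det ≠ 0 := by
  intro h
  obtain ⟨v, hv, hv0⟩ := Matrix.exists_mulVec_eq_zero_iff.2 h
  apply hv
  have hx : v = Matrix.vecMul (simplexCoeff d v) (Matrix.of (simplexVertex d)) := by
    rw [Matrix.vecMul_eq_sum]
    exact sum_simplexCoeff_smul d v
  have h2 : v ⬝ᵥ v = 0 := by
    conv_lhs => enter [1]; rw [hx]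
    rw [← Matrix.dotProduct_mulVec, hv0, dotProduct_zero]
  exact dotProduct_self_eq_zero.1 h2

theorem simplexCoeff_pos {d : ℕ} {x : Fin (d + 1) → ℝ} (hx : x ∈ unitCube d) (j : Fin (d + 1)) :
    0 < simplexCoeff d x j := by
  have hd : (0 : ℝ) < 3 * d + 1 := by positivity
  rw [simplexCoeff, hx.1]
  split_ifs
  · have : ∑ i : Fin d, (x i.castSucc + 2 * 1) / (3 * d + 1) ≤
        ∑ _i : Fin d, 3 / (3 * (d : ℝ) + 1) := by
      refine Finset.sum_le_sum fun i _ => ?_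
      have := (abs_le.1 (hx.2 i.castSucc)).2
      gcongr
      linarith
    rw [Finset.sum_const, Finset.card_univ, Fintype.card_fin, nsmul_eq_mul] at this
    have h2 : (d : ℝ) * (3 / (3 * d + 1)) < 1 := by
      rw [← mul_div_assoc, div_lt_one hd]
      linarith
    linarith
  · have := (abs_le.1 (hx.2 j)).1
    apply div_pos _ hd
    linarith

theorem simplexCoeff_beyondVertex_last {d : ℕ} (hd : 0 < d) :
    simplexCoeff d (beyondVertex d) (Fin.last d) = -1 := by
  have hd' : (0 : ℝ) < d := by exact_mod_cast hd
  simp [simplexCoeff, beyondVertex, Fin.castSucc_ne_last]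
  field_simp
  ring

theorem simplexCoeff_beyondVertex_pos (d : ℕ) {j : Fin (d + 1)} (hj : j ≠ Fin.last d) :
    0 < simplexCoeff d (beyondVertex d) j := by
  simp only [simplexCoeff, beyondVertex, hj, if_false, if_true]
  positivity

/-- The position of the unit cube and of the additional point relative to the simplex is stable
under small perturbations of all vertices. -/
theorem exists_radius_scaledCoeff {d : ℕ} (hd : 0 < d) :
    ∃ δ : ℝ, 0 < δ ∧ δ ≤ 1 / 2 ∧ ∀ (w : Fin (d + 1) → Fin (d + 1) → ℝ) (q : Fin (d + 1) → ℝ),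
      (∀ j, w j ∈ Metric.ball (simplexVertex d j) δ) → q ∈ Metric.ball (beyondVertex d) δ →
      (∀ x ∈ unitCube d, ∀ j, 0 < scaledCoeff w x j) ∧
      scaledCoeff w q (Fin.last d) < 0 ∧ ∀ j, j ≠ Fin.last d → 0 < scaledCoeff w q j := by
  have hdet : 0 < (Matrix.of (simplexVertex d)).det ^ 2 :=
    pow_pos (lt_of_le_of_ne (abs_nonneg _) (abs_ne_zero.2 (det_simplexVertex_ne_zero d)).symm) 2
      |>.trans_eq (sq_abs _)
  have hbase : ∀ x j, scaledCoeff (simplexVertex d) x j =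
      (Matrix.of (simplexVertex d)).det ^ 2 * simplexCoeff d x j := fun x j => by
    rw [scaledCoeff_eq (sum_simplexCoeff_smul d x)]
    rfl
  have h1 : ∀ᶠ w in nhds (simplexVertex d), ∀ x ∈ unitCube d, ∀ j, 0 < scaledCoeff w x j := by
    refine (isCompact_unitCube d).eventually_forall_of_forall_eventually fun x hx => ?_
    rw [Filter.eventually_all]
    intro j
    refine (continuous_scaledCoeff j).continuousAt.eventually_const_lt ?_
    dsimp only
    rw [hbase]
    exact mul_pos hdet (simplexCoeff_pos hx j)
  have h2 : ∀ᶠ p in nhds (simplexVertex d, beyondVertex d),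
      scaledCoeff p.1 p.2 (Fin.last d) < 0 := by
    refine (continuous_scaledCoeff _).continuousAt.eventually_lt_const ?_
    dsimp only
    rw [hbase, simplexCoeff_beyondVertex_last hd]
    linarith
  have h3 : ∀ᶠ p in nhds (simplexVertex d, beyondVertex d),
      ∀ j, j ≠ Fin.last d → 0 < scaledCoeff p.1 p.2 j := by
    rw [Filter.eventually_all]
    intro j
    rw [Filter.eventually_all]
    intro hj
    refine (continuous_scaledCoeff _).continuousAt.eventually_const_lt ?_
    dsimp only
    rw [hbase]
    exact mul_pos hdet (simplexCoeff_beyondVertex_pos d hj)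
  have h1' : ∀ᶠ p in nhds (simplexVertex d, beyondVertex d), ∀ x ∈ unitCube d, ∀ j,
      0 < scaledCoeff p.1 x j := by
    rw [nhds_prod_eq]
    exact h1.prod_inl _
  obtain ⟨δ, hδ, hball⟩ := Metric.eventually_nhds_iff_ball.1 (h1'.and (h2.and h3))
  refine ⟨min δ (1 / 2), by positivity, min_le_right _ _, fun w q hw hq => ?_⟩
  refine hball (w, q) ?_
  rw [Metric.mem_ball, Prod.dist_eq, max_lt_iff]
  refine ⟨(dist_pi_lt_iff hδ).2 fun j => ?_, ?_⟩
  · exact (Metric.mem_ball.1 (hw j)).trans_le (min_le_left _ _)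
  · exact (Metric.mem_ball.1 hq).trans_le (min_le_left _ _)

/-- The vertices of the simplex together with the point beyond one of its facets. -/
def bipyramidVertex (d : ℕ) : Option (Fin (d + 1)) → Fin (d + 1) → ℝ
  | none => beyondVertex d
  | some j => simplexVertex d j

theorem bipyramidVertex_last (d : ℕ) (o : Option (Fin (d + 1))) :
    bipyramidVertex d o (Fin.last d) = 1 := by
  rcases o with _ | j <;> simp [bipyramidVertex, beyondVertex, simplexVertex]

theorem Fin.exists_ne_and_ne_last {d : ℕ} (hd : 2 ≤ d) (j : Fin (d + 1)) :
    ∃ i, i ≠ j ∧ i ≠ Fin.last d := by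
  obtain ⟨i, hi⟩ := Finset.exists_mem_notMem_of_card_lt_card
    (s := {j, Fin.last d}) (t := (Finset.univ : Finset (Fin (d + 1))))
    (by
      have := Finset.card_le_two (a := j) (b := Fin.last d)
      rw [Finset.card_univ, Fintype.card_fin]
      omega)
  simp only [Finset.mem_insert, Finset.mem_singleton, not_or] at hi
  exact ⟨i, hi.2⟩

theorem one_le_dist_bipyramidVertex {d : ℕ} (hd : 2 ≤ d) {o o' : Option (Fin (d + 1))}
    (h : o ≠ o') : 1 ≤ dist (bipyramidVertex d o) (bipyramidVertex d o') := by
  have hd' : (2 : ℝ) ≤ d := by exact_mod_cast hd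
  have hq : ∀ j, 1 ≤ dist (beyondVertex d) (simplexVertex d j) := by
    intro j
    obtain ⟨i, hij, hil⟩ := Fin.exists_ne_and_ne_last hd j
    refine le_trans ?_ (dist_le_pi_dist _ _ i)
    simp only [beyondVertex, simplexVertex, hij, hil, if_false, Real.dist_eq]
    refine le_trans ?_ (le_abs_self _)
    have : (0 : ℝ) ≤ 2 / d := by positivity
    linarith
  have hw : ∀ j j', j ≠ j' → j ≠ Fin.last d →
      1 ≤ dist (simplexVertex d j) (simplexVertex d j') := by
    intro j j' hj hl
    refine le_trans ?_ (dist_le_pi_dist _ _ j)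
    simp only [simplexVertex, hj, hl, if_false, if_true, Real.dist_eq]
    refine le_trans ?_ (le_abs_self _)
    linarith
  rcases o with _ | j <;> rcases o' with _ | j'
  · exact absurd rfl h
  · exact hq j'
  · rw [dist_comm]
    exact hq j
  · have hjj : j ≠ j' := fun e => h (e ▸ rfl)
    by_cases hl : j = Fin.last d
    · have hl' : j' ≠ Fin.last d := fun e => hjj (hl.trans e.symm)
      rw [dist_comm]
      exact hw j' j hjj.symm hl'
    · exact hw j j' hjj hl

theorem disjoint_ball_bipyramidVertex {d : ℕ} (hd : 2 ≤ d) {δ : ℝ} (hδ : δ ≤ 1 / 2)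
    {o o' : Option (Fin (d + 1))} (h : o ≠ o') :
    Disjoint (Metric.ball (bipyramidVertex d o) δ) (Metric.ball (bipyramidVertex d o') δ) :=
  Metric.ball_disjoint_ball (by linarith [one_le_dist_bipyramidVertex hd h])

theorem disjoint_ball_unitCube {d : ℕ} (hd : 2 ≤ d) {δ : ℝ} (hδ : δ ≤ 1 / 2)
    (o : Option (Fin (d + 1))) :
    Disjoint (Metric.ball (bipyramidVertex d o) δ) (unitCube d) := by
  rw [Set.disjoint_left]
  intro x hx hxK
  obtain ⟨i, hi⟩ : ∃ i, 2 ≤ |bipyramidVertex d o i| := by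
    rcases o with _ | j
    · obtain ⟨i, -, hil⟩ := Fin.exists_ne_and_ne_last hd 0
      refine ⟨i, ?_⟩
      simp only [bipyramidVertex, beyondVertex, hil, if_false]
      refine le_trans ?_ (le_abs_self _)
      have : (0 : ℝ) ≤ 2 / d := by positivity
      linarith
    · obtain ⟨i, hij, hil⟩ := Fin.exists_ne_and_ne_last hd j
      refine ⟨i, ?_⟩
      simp [bipyramidVertex, simplexVertex, hij, hil]
  have h1 := (dist_le_pi_dist x (bipyramidVertex d o) i).trans_lt hx
  rw [Real.dist_eq, abs_sub_comm] at h1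
  have h2 := abs_sub_abs_le_abs_sub (bipyramidVertex d o i) (x i)
  linarith [hxK.2 i]

end

/-! ### The face count on the two events -/

/-- Linear relations survive an injective linear map and positive rescaling of the vectors. -/
theorem smul_map_eq_sum {ι J E F : Type*} [Fintype J] [AddCommGroup E] [Module ℝ E]
    [AddCommGroup F] [Module ℝ F] {L : F →ₗ[ℝ] E} {x : ι → E} {y : ι → F} {s : ι → ℝ}
    (hs : ∀ i, 0 < s i) (hx : ∀ i, x i = s i • L (y i)) {σ : J → ι} {i : ι} {c : J → ℝ}
    (h : y i = ∑ j, c j • y (σ j)) : x i = ∑ j, (s i * c j / s (σ j)) • x (σ j) := by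
  rw [hx i, h, map_sum, Finset.smul_sum]
  refine Finset.sum_congr rfl fun j _ => ?_
  rw [hx (σ j), map_smul, smul_smul, smul_smul, div_mul_cancel₀ _ (hs (σ j)).ne']

theorem linearIndependent_smul_map {ι J E F : Type*} [AddCommGroup E] [Module ℝ E]
    [AddCommGroup F] [Module ℝ F] {L : F →ₗ[ℝ] E} (hL : LinearMap.ker L = ⊥) {x : ι → E}
    {y : ι → F} {s : ι → ℝ} (hs : ∀ i, 0 < s i) (hx : ∀ i, x i = s i • L (y i)) {σ : J → ι}
    (h : LinearIndependent ℝ fun j => y (σ j)) : LinearIndependent ℝ fun j => x (σ j) := by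
  have h2 := (h.map' L hL).units_smul fun j => Units.mk0 (s (σ j)) (hs (σ j)).ne'
  have e : (fun j => x (σ j)) =
      (fun j => Units.mk0 (s (σ j)) (hs (σ j)).ne') • (L ∘ fun j => y (σ j)) :=
    funext fun j => hx (σ j)
  rw [e]
  exact h2

/-- If the points `x (σ j)` project gnomonically close to the vertices of the simplex, they are
linearly independent; points that project into the unit cube are positive combinations of them, and
points that project close to the additional vertex lie beyond exactly one facet of their cone. -/
theorem gnomonicCell_relations {d n : ℕ} {ε δ : ℝ} (hε : 0 < ε)
    (hδ : ∀ (w : Fin (d + 1) → Fin (d + 1) → ℝ) (q : Fin (d + 1) → ℝ),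
      (∀ j, w j ∈ Metric.ball (simplexVertex d j) δ) → q ∈ Metric.ball (beyondVertex d) δ →
      (∀ x ∈ unitCube d, ∀ j, 0 < scaledCoeff w x j) ∧
      scaledCoeff w q (Fin.last d) < 0 ∧ ∀ j, j ≠ Fin.last d → 0 < scaledCoeff w q j)
    (hδ0 : 0 < δ) {x : Fin n → UnitSphere d}
    (hpos : ∀ i, 0 < (x i : EuclideanSpace ℝ (Fin (d + 1))) (Fin.last d))
    {σ : Fin (d + 1) → Fin n}
    (hσ : ∀ j, x (σ j) ∈ gnomonicCell d ε (Metric.ball (simplexVertex d j) δ)) :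
    (LinearIndependent ℝ fun j => (x (σ j) : EuclideanSpace ℝ (Fin (d + 1)))) ∧
    (∀ i, x i ∈ gnomonicCell d ε (unitCube d) → ∃ c : Fin (d + 1) → ℝ, (∀ j, 0 < c j) ∧
      (x i : EuclideanSpace ℝ (Fin (d + 1))) = ∑ j, c j • (x (σ j) : EuclideanSpace ℝ _)) ∧
    ∀ i, x i ∈ gnomonicCell d ε (Metric.ball (beyondVertex d) δ) →
      ∃ c : Fin (d + 1) → ℝ, c (Fin.last d) < 0 ∧ (∀ j, j ≠ Fin.last d → 0 < c j) ∧
      (x i : EuclideanSpace ℝ (Fin (d + 1))) = ∑ j, c j • (x (σ j) : EuclideanSpace ℝ _) := by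
  let L : (Fin (d + 1) → ℝ) →ₗ[ℝ] EuclideanSpace ℝ (Fin (d + 1)) :=
    scaleLast d ε ∘ₗ (WithLp.linearEquiv 2 ℝ (Fin (d + 1) → ℝ)).symm.toLinearMap
  have hL : LinearMap.ker L = ⊥ := by
    have h : LinearMap.ker (scaleLast d ε) = ⊥ := by
      by_contra h
      have := LinearMap.det_eq_zero_iff_ker_ne_bot.2 h
      rw [det_scaleLast] at this
      exact hε.ne' this
    rw [LinearMap.ker_comp, h, Submodule.comap_bot, LinearEquiv.ker]
  let y : Fin n → Fin (d + 1) → ℝ := fun i => gnomonic ε (x i : EuclideanSpace ℝ (Fin (d + 1)))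
  let s : Fin n → ℝ := fun i => (x i : EuclideanSpace ℝ (Fin (d + 1))) (Fin.last d) / ε
  have hs : ∀ i, 0 < s i := fun i => div_pos (hpos i) hε
  have hx : ∀ i, (x i : EuclideanSpace ℝ (Fin (d + 1))) = s i • L (y i) := fun i =>
    eq_smul_scaleLast_gnomonic hε (hpos i)
  have hw : ∀ j, y (σ j) ∈ Metric.ball (simplexVertex d j) δ := fun j => (hσ j).2
  have hcube := (hδ (fun j => y (σ j)) _ hw (Metric.mem_ball_self hδ0)).1
  have hdet : (Matrix.of fun j => y (σ j)).det ≠ 0 := by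
    intro h0
    have := hcube (fun i => if i = Fin.last d then 1 else 0)
      ⟨by simp, fun i => by dsimp only; split_ifs <;> simp⟩ 0
    simp [scaledCoeff, h0] at this
  have hdet2 : 0 < (Matrix.of fun j => y (σ j)).det ^ 2 := pow_two_pos_of_ne_zero hdet
  refine ⟨linearIndependent_smul_map hL hs hx (Matrix.linearIndependent_rows_of_det_ne_zero hdet),
    fun i hi => ?_, fun i hi => ?_⟩
  · have h := smul_map_eq_sum (x := fun i => (x i : EuclideanSpace ℝ (Fin (d + 1)))) hs hx
      (sum_scaledCoeff_smul hdet (y i))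
    exact ⟨_, fun j => div_pos (mul_pos (hs i) (div_pos (hcube _ hi.2 j) hdet2)) (hs _), h⟩
  · have h := smul_map_eq_sum (x := fun i => (x i : EuclideanSpace ℝ (Fin (d + 1)))) hs hx
      (sum_scaledCoeff_smul hdet (y i))
    obtain ⟨-, hneg, hp⟩ := hδ (fun j => y (σ j)) _ hw hi.2
    exact ⟨_, div_neg_of_neg_of_pos (mul_neg_of_pos_of_neg (hs i)
      (div_neg_of_neg_of_pos hneg hdet2)) (hs _),
      fun j hj => div_pos (mul_pos (hs i) (div_pos (hp j hj) hdet2)) (hs _), h⟩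

/-- For every number of points there is a scale at which all cells around the vertices have
probability of order `1 / n`, and the complement of the cell of the cube has probability at most
`1 / (2 * n)`. -/
theorem exists_scale {d : ℕ} {α : ℝ} (hα : -1 < α) {δ : ℝ} (hδ : 0 < δ) :
    ∃ a : ℝ, 0 < a ∧ ∀ n : ℕ, 0 < n → ∃ ε : ℝ, 0 < ε ∧
      (∀ o, ENNReal.ofReal (a / n) ≤
        hemisphereLaw d α (gnomonicCell d ε (Metric.ball (bipyramidVertex d o) δ))) ∧
      ENNReal.ofReal (1 - 1 / (2 * n)) ≤ hemisphereLaw d α (gnomonicCell d ε (unitCube d)) := by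
  have := isProbabilityMeasure_hemisphereLaw d hα
  obtain ⟨b, hb, hbε⟩ := exists_hemisphereLaw_compl_le (d := d) hα
  choose a' ha' ha'ε using fun o => exists_le_hemisphereLaw_gnomonicCell hα
    (Metric.isOpen_ball (x := bipyramidVertex d o) (ε := δ)) (Metric.mem_ball_self hδ)
    (bipyramidVertex_last d o)
  let a := Finset.univ.inf' Finset.univ_nonempty a'
  have ha : 0 < a := (Finset.lt_inf'_iff _).2 fun o _ => ha' o
  have haa : ∀ o, a ≤ a' o := fun o => Finset.inf'_le _ (Finset.mem_univ o)
  have hα1 : 0 < α + 1 := by linarith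
  refine ⟨a / (2 * (b + 1)), by positivity, fun n hn => ?_⟩
  have hn1 : (1 : ℝ) ≤ n := by exact_mod_cast hn
  have hn0 : (0 : ℝ) < n := by linarith
  -- The scale is chosen such that `ε ^ (α + 1)` is the following number.
  set t : ℝ := 1 / (2 * (b + 1) * n) with ht
  have ht0 : 0 < t := by positivity
  have ht1 : t ≤ 1 := by
    rw [ht, div_le_one (by positivity)]
    nlinarith
  set ε := t ^ (α + 1)⁻¹ with hε
  have hεt : ε ^ (α + 1) = t := Real.rpow_inv_rpow ht0.le hα1.ne'
  have hε0 : 0 < ε := by positivity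
  have hε1 : ε ≤ 1 := Real.rpow_le_one ht0.le ht1 (by positivity)
  refine ⟨ε, hε0, fun o => ?_, ?_⟩
  · refine le_trans (ENNReal.ofReal_le_ofReal ?_) (ha'ε o ε hε0 hε1)
    rw [hεt]
    calc a / (2 * (b + 1)) / n = a * t := by rw [ht]; field_simp
      _ ≤ _ := by gcongr; exact haa o
  · have hm := measurableSet_gnomonicCell (d := d) ε (isCompact_unitCube d).measurableSet
    have h := hbε ε hε0 hε1
    rw [hεt, prob_compl_eq_one_sub hm, tsub_le_iff_right] at h
    have h2 : ENNReal.ofReal (b * t) ≤ ENNReal.ofReal (1 / (2 * n)) := by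
      apply ENNReal.ofReal_le_ofReal
      rw [ht]
      have : b * (1 / (2 * (b + 1) * n)) = b / (b + 1) * (1 / (2 * n)) := by field_simp
      rw [this]
      refine mul_le_of_le_one_left (by positivity) ?_
      rw [div_le_one (by positivity)]
      linarith
    rw [ENNReal.ofReal_sub _ (by positivity), ENNReal.ofReal_one, tsub_le_iff_left]
    exact h.trans (by gcongr)

/-! ### The variance bound -/

theorem mainTheorem4 (d : ℕ) (hd : 2 ≤ d) (α : ℝ) (hα : -1 < α) (k : ℕ) (hk : k < d) :
    ∃ c : ℝ, 0 < c ∧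
      ∀ n : ℕ, d + 2 ≤ n →
      ∀ (Ω : Type*) [MeasurableSpace Ω] (P : Measure Ω) [IsProbabilityMeasure P]
        (X : Fin n → Ω → UnitSphere d),
        iIndepFun X P → (∀ i, HasLaw (X i) (hemisphereLaw d α) P) →
          MemLp (fun ω => (sphericalFaceCount k (sphericalPolytope fun i => X i ω) : ℝ)) 2 P ∧
          c ≤ Var[fun ω => (sphericalFaceCount k (sphericalPolytope fun i => X i ω) : ℝ); P] := by
  obtain ⟨δ, hδ0, hδ1, hδ⟩ := exists_radius_scaledCoeff (d := d) (by omega)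
  obtain ⟨a, ha, hscale⟩ := exists_scale (d := d) hα hδ0
  let p : ℕ → ℝ := fun m => (a / m) ^ m / 2
  have hp : ∀ m, 0 < m → 0 < p m := fun m hm => by
    have : (0 : ℝ) < m := by exact_mod_cast hm
    positivity
  refine ⟨min (p (d + 1)) (p (d + 2)) / 4, by
    have := lt_min (hp (d + 1) (by omega)) (hp (d + 2) (by omega))
    positivity, ?_⟩
  intro n hn Ω _ P _ X hind hlaw
  obtain ⟨ε, hε, hcell, hcube⟩ := hscale n (by omega)
  have hmem : MemLp
      (fun ω => (sphericalFaceCount k (sphericalPolytope fun i => X i ω) : ℝ)) 2 P := by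
    refine MemLp.of_bound (C := 2 ^ n) ?_ (Filter.Eventually.of_forall fun ω => ?_)
    · refine AEMeasurable.aestronglyMeasurable ?_
      exact ((measurable_of_countable (fun m : ℕ => (m : ℝ))).comp
        (measurable_sphericalFaceCount d n k)).comp_aemeasurable
        (aemeasurable_pi_lambda _ fun i => (hlaw i).aemeasurable)
    · rw [Real.norm_of_nonneg (by positivity)]
      exact_mod_cast sphericalFaceCount_le k fun i => X i ω
  refine ⟨hmem, ?_⟩
  have hcellm : ∀ o, MeasurableSet
      (gnomonicCell d ε (Metric.ball (bipyramidVertex d o) δ)) := fun o =>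
    measurableSet_gnomonicCell ε measurableSet_ball
  have hcubem : MeasurableSet (gnomonicCell d ε (unitCube d)) :=
    measurableSet_gnomonicCell ε (isCompact_unitCube d).measurableSet
  have hdisj : ∀ o o', o ≠ o' → Disjoint (gnomonicCell d ε (Metric.ball (bipyramidVertex d o) δ))
      (gnomonicCell d ε (Metric.ball (bipyramidVertex d o') δ)) := fun o o' h =>
    gnomonicCell_disjoint ε (disjoint_ball_bipyramidVertex hd hδ1 h)
  have hdisjc : ∀ o, Disjoint (gnomonicCell d ε (Metric.ball (bipyramidVertex d o) δ))
      (gnomonicCell d ε (unitCube d)) := fun o =>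
    gnomonicCell_disjoint ε (disjoint_ball_unitCube hd hδ1 o)
  -- On the first event the cone is simplicial, on the second it is a cone over a bipyramid.
  have hA := le_prob_exists_embedding (J := Fin (d + 1)) (by rw [Fintype.card_fin]; omega) hind hlaw
    (fun j => hcellm (some j)) hcubem
    (fun j j' h => hdisj _ _ fun e => h (Option.some_injective _ e)) (fun j => hdisjc (some j))
    ha.le (fun j => hcell (some j)) hcube
  have hB := le_prob_exists_embedding (J := Option (Fin (d + 1)))
    (by rw [Fintype.card_option, Fintype.card_fin]; omega) hind hlaw
    hcellm hcubem hdisj hdisjc ha.le hcell hcube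
  rw [Fintype.card_fin] at hA
  rw [Fintype.card_option, Fintype.card_fin] at hB
  refine div_four_le_variance hmem (m := (d + 1).choose (k + 1)) ?_ ?_
    ((ENNReal.ofReal_le_ofReal (min_le_left _ _)).trans hA)
    ((ENNReal.ofReal_le_ofReal (min_le_right _ _)).trans hB)
  · rintro ω ⟨σ, hσ, hσc⟩
    have hpos : ∀ i, 0 < (X i ω : EuclideanSpace ℝ (Fin (d + 1))) (Fin.last d) := by
      intro i
      by_cases hi : i ∈ Set.range σ
      · obtain ⟨j, rfl⟩ := hi
        exact (hσ j).1
      · exact (hσc i hi).1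
    obtain ⟨hli, hin, -⟩ := gnomonicCell_relations hε hδ hδ0 hpos (σ := σ) hσ
    rw [sphericalFaceCount_eq]
    have h := ncard_exposed_le_choose (σ := σ)
      (x := fun i => (X i ω : EuclideanSpace ℝ (Fin (d + 1)))) hli
      (fun i hi => hin i (hσc i hi)) (k := k) (by rw [Fintype.card_fin]; omega)
    rw [Fintype.card_fin] at h
    exact_mod_cast h
  · rintro ω ⟨σ, hσ, hσc⟩
    have hpos : ∀ i, 0 < (X i ω : EuclideanSpace ℝ (Fin (d + 1))) (Fin.last d) := by
      intro i
      by_cases hi : i ∈ Set.range σ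
      · obtain ⟨o, rfl⟩ := hi
        exact (hσ o).1
      · exact (hσc i hi).1
    obtain ⟨hli, hin, hout⟩ := gnomonicCell_relations hε hδ hδ0 hpos
      (σ := fun j => σ (some j)) fun j => hσ (some j)
    obtain ⟨c, hc0, hc, hq⟩ := hout (σ none) (hσ none)
    rw [sphericalFaceCount_eq]
    have h := choose_lt_ncard_exposed (σ := σ)
      (x := fun i => (X i ω : EuclideanSpace ℝ (Fin (d + 1)))) hli hc0 hc hq
      (fun i hi => hin i (hσc i hi)) hd hk
    exact_mod_cast h
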